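/- There are a single deterministic algorithm (a fixed random access machine program over the integers, with the operations $+,-,\times$, integer division and comparisons, with variables and arrays, each operation and each memory access counted as one step) and an absolute constant $C$ such that the following holds. For every $n\ge 1$, every $a\in\mathbb{Z}^n$ and $b\in\mathbb{Z}$ of arbitrary signs, and every rational $\varepsilon>0$, let $P=[0,1]^n\cap\{x\in\mathbb{R}^n : a^\top x\le b\}$, let $L$ be the maximum encoding length of the input parameters $a_1,\dots,a_n,b,\varepsilon$, where a rational $p/q$ in lowest terms has encoding length $\lceil\log_2(|p|+1)\rceil+\lceil\log_2(q+1)\rceil$, and put $\varepsilon'=\min\{\varepsilon,1\}$. On input $(n,a,b,\varepsilon)$ the algorithm halts and outputs a number $Z'$ with \[\mathrm{vol}(P)\le Z'\le(1+\varepsilon)\,\mathrm{vol}(P),\] after at most \[C\cdot\frac{n^3}{\varepsilon'}\Bigl(\log_2\frac{n}{\varepsilon'}+L\Bigr)^4\] operations, all of them on integers of at most $C\,\bigl(L+\log_2(n/\varepsilon')\bigr)$ bits. The output is a floating-point number $Z'=m\cdot 2^{k}$, where the integers $m,k$ also have at most that many bits. -/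

import Mathlib

namespace TruncatedCube

/-- The number of binary digits `⌈log₂ (|z| + 1)⌉` of an integer. -/
def bitLength (z : ℤ) : ℕ := Nat.clog 2 (z.natAbs + 1)

/-- The encoding length `⌈log₂ (|p| + 1)⌉ + ⌈log₂ (q + 1)⌉` of a rational `p / q` in lowest terms. -/
def encodingLength (r : ℚ) : ℕ := bitLength r.num + bitLength r.den

/-! ### Random access machine programs over the integers

A program works on scalar variables and on arrays, all of which hold integers. Its text is finite
and does not depend on the input, so it names only finitely many variables and arrays. Array
indices are computed values, so they are subject to the bound on the bit length too. -/

/-- The primitive operations: integer arithmetic and comparisons. -/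
inductive Op where
  | add | sub | mul | div | lt | le | eq

/-- `div` is integer division, rounding down for a positive divisor, with `x / 0 = 0`;
a comparison returns `1` if it holds and `0` if it fails. -/
def Op.apply : Op → ℤ → ℤ → ℤ
  | .add, x, y => x + y
  | .sub, x, y => x - y
  | .mul, x, y => x * y
  | .div, x, y => x / y
  | .lt, x, y => if x < y then 1 else 0
  | .le, x, y => if x ≤ y then 1 else 0
  | .eq, x, y => if x = y then 1 else 0

/-- The memory of the machine: scalar variables and arrays. -/
structure State where
  var : ℕ → ℤ
  arr : ℕ → ℤ → ℤ

/-- `σ.setVar x v` is the memory after the assignment `x := v`. -/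
def State.setVar (σ : State) (x : ℕ) (v : ℤ) : State :=
  { σ with var := Function.update σ.var x v }

/-- `σ.setArr A i v` is the memory after the assignment `A[i] := v`. -/
def State.setArr (σ : State) (A : ℕ) (i v : ℤ) : State :=
  { σ with arr := Function.update σ.arr A (Function.update (σ.arr A) i v) }

/-- Expressions: a literal, a variable, an array entry `A[e]`, or an operation on two values. -/
inductive Expr where
  | lit (c : ℤ)
  | var (x : ℕ)
  | get (A : ℕ) (e : Expr)
  | bin (o : Op) (e f : Expr)

def Expr.eval (σ : State) : Expr → ℤ
  | .lit c => c
  | .var x => σ.var x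
  | .get A e => σ.arr A (e.eval σ)
  | .bin o e f => o.apply (e.eval σ) (f.eval σ)

/-- The cost of evaluating an expression: one unit for each literal, each memory access and each
operation that occurs in it. -/
def Expr.cost : Expr → ℕ
  | .lit _ => 1
  | .var _ => 1
  | .get _ e => e.cost + 1
  | .bin _ e f => e.cost + f.cost + 1

/-- Every number that occurs in the evaluation of the expression, intermediate values and array
indices included, has at most `B` bits. -/
def Expr.Fits (B : ℕ) (σ : State) : Expr → Prop
  | .lit c => bitLength c ≤ B
  | .var x => bitLength (σ.var x) ≤ B
  | .get A e => e.Fits B σ ∧ bitLength (σ.arr A (e.eval σ)) ≤ B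
  | .bin o e f => e.Fits B σ ∧ f.Fits B σ ∧ bitLength (o.apply (e.eval σ) (f.eval σ)) ≤ B

/-- Programs: `x := e`, `A[i] := e`, sequencing, branching on `e ≠ 0`, looping while `e ≠ 0`. -/
inductive Prog where
  | skip
  | set (x : ℕ) (e : Expr)
  | put (A : ℕ) (i e : Expr)
  | seq (p q : Prog)
  | cond (e : Expr) (p q : Prog)
  | loop (e : Expr) (p : Prog)

/-- `Exec B p σ t τ`: started in the memory `σ`, the program `p` halts in the memory `τ` after `t`
operations, and every number that it handles on the way has at most `B` bits. Arithmetic,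
comparisons, literals, memory accesses, assignments and branchings count one operation each. -/
inductive Exec (B : ℕ) : Prog → State → ℕ → State → Prop where
  | skip (σ : State) : Exec B .skip σ 0 σ
  | set (x : ℕ) (e : Expr) (σ : State) (he : e.Fits B σ) :
      Exec B (.set x e) σ (e.cost + 1) (σ.setVar x (e.eval σ))
  | put (A : ℕ) (i e : Expr) (σ : State) (hi : i.Fits B σ) (he : e.Fits B σ) :
      Exec B (.put A i e) σ (i.cost + e.cost + 1) (σ.setArr A (i.eval σ) (e.eval σ))
  | seq (p q : Prog) (σ τ υ : State) (s t : ℕ) (hp : Exec B p σ s τ) (hq : Exec B q τ t υ) :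
      Exec B (.seq p q) σ (s + t) υ
  | cond_true (e : Expr) (p q : Prog) (σ τ : State) (t : ℕ) (he : e.Fits B σ)
      (h : e.eval σ ≠ 0) (hp : Exec B p σ t τ) : Exec B (.cond e p q) σ (e.cost + 1 + t) τ
  | cond_false (e : Expr) (p q : Prog) (σ τ : State) (t : ℕ) (he : e.Fits B σ)
      (h : e.eval σ = 0) (hq : Exec B q σ t τ) : Exec B (.cond e p q) σ (e.cost + 1 + t) τ
  | loop_true (e : Expr) (p : Prog) (σ τ υ : State) (s t : ℕ) (he : e.Fits B σ)
      (h : e.eval σ ≠ 0) (hp : Exec B p σ s τ) (hl : Exec B (.loop e p) τ t υ) :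
      Exec B (.loop e p) σ (e.cost + 1 + s + t) υ
  | loop_false (e : Expr) (p : Prog) (σ : State) (he : e.Fits B σ) (h : e.eval σ = 0) :
      Exec B (.loop e p) σ (e.cost + 1) σ

/-! ### The problem -/

/-- The polytope `[0,1]ⁿ ∩ {x : aᵀx ≤ b}`. -/
def polytope {n : ℕ} (a : Fin n → ℤ) (b : ℤ) : Set (Fin n → ℝ) :=
  {x | (∀ i, x i ∈ Set.Icc (0 : ℝ) 1) ∧ ∑ i, (a i : ℝ) * x i ≤ (b : ℝ)}

/-- The `n`-dimensional volume (Lebesgue measure) of the polytope. -/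
noncomputable def vol {n : ℕ} (a : Fin n → ℤ) (b : ℤ) : ℝ :=
  MeasureTheory.volume.real (polytope a b)

/-- The maximum encoding length of an input parameter, the parameters being the entries of `a`,
the number `b` and the error parameter `ε`. -/
def inputLength {n : ℕ} (a : Fin n → ℤ) (b : ℤ) (ε : ℚ) : ℕ :=
  max (Finset.univ.sup fun i => encodingLength (a i))
    (max (encodingLength b) (encodingLength ε))

/-- The initial memory: `n`, `b` and the numerator and denominator of `ε` in the variables
`0, 1, 2, 3`, the vector `a` in the entries `0, …, n - 1` of array `0`, and zeros elsewhere. -/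
def input {n : ℕ} (a : Fin n → ℤ) (b : ℤ) (ε : ℚ) : State where
  var := fun
    | 0 => n
    | 1 => b
    | 2 => ε.num
    | 3 => ε.den
    | _ => 0
  arr := fun
    | 0 => fun i => if h : 0 ≤ i ∧ i < n then a ⟨i.toNat, by omega⟩ else 0
    | _ => fun _ => 0

/-- The real number that the final memory represents: the floating-point number `m * 2 ^ k`
with the integers `m` and `k` in the variables `0` and `1`. -/
noncomputable def output (σ : State) : ℝ := (σ.var 0 : ℝ) * (2 : ℝ) ^ (σ.var 1)

end TruncatedCube

namespace TruncatedCube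
open MeasureTheory
open scoped Pointwise

/-! Reflections `x i ↦ 1 - x i` make all coefficients nonnegative (`vol_eq_vol_abs`). After that a
right-hand side that is not positive gives volume zero, unless the polytope is the whole cube, in
which case the right-hand side can be raised freely. Let `r = ⌊1/ε⌋ + 1` and `M = 8 n² r`, scale the
inequality to `∑ w i x i ≤ M` with `w i = a i M / b`, and cut the `i`-th axis into `k i = ⌊w i⌋ + 1`
equal pieces. The grid boxes with index sum at most `M + n` cover the polytope, and all of them
satisfy `∑ w i x i ≤ M + 2 n`. That larger body lies in the dilate of the polytope by `1 + 2 n / M`,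
so the number of these boxes divided by `∏ k i` exceeds the volume by a factor of at most `(1 + 2 n
/ M) ^ n ≤ exp (1 / (4 r))` (`vol_le_cnt_le`). The `k i` may be exponential in the input length, but
the index sums that matter stay below `M + n`.

The boxes are counted by dynamic programming over the coordinates: a further coordinate replaces the
table of counts by its sums over windows of length `k i` (`window_cnt`). The length is capped at the
size of the table (`window_min`), and the window is assembled from windows of lengths `1, 2, 4, …`
along its binary digits (`window_add`, `runs_windowSum`).

The counts are too large to be stored exactly. They are kept as floating-point numbers with about
`q` bits of mantissa, always rounded upward. One addition costs at most two factors `1 + 2 / 2 ^ q`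
(`Cell.add`, `approx_normalize`), a coordinate costs `2 (q + 1)` of them, and the final division by
`k i` two more (`Approx.div`). For the `q` given by `precision` the rounding contributes at most
another factor `exp (1 / (4 r))`, and `exp (1 / (2 r)) ≤ 1 + 1 / r ≤ 1 + ε` (`error_le`).

There are `n` coordinates, `O(q)` table additions for each and `O(n² r)` cells in the table, where
`r ≤ 2 / ε'` and `q = O(log (n / ε') + L)`. Hence the first power of the last factor suffices in the
time bound. The predicate `Runs` carries correctness, running time and bit length through the
program at once. -/

/-! ### Discretization: volume versus lattice point count. -/

/-- The number of vectors `z` with `0 ≤ z i < k i` for `i < n` and coordinate sum at most `y`. -/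
def cnt (k : ℕ → ℕ) : ℕ → ℤ → ℕ
  | 0, y => if 0 ≤ y then 1 else 0
  | i + 1, y => ∑ t ∈ Finset.range (k i), cnt k i (y - t)

theorem cnt_eq_card (k : ℕ → ℕ) (n : ℕ) (y : ℤ) :
    cnt k n y = (Finset.univ.filter
      fun f : (∀ i : Fin n, Fin (k i)) => ∑ i, ((f i : ℕ) : ℤ) ≤ y).card := by
  rw [Finset.card_filter]
  induction n generalizing y with
  | zero => simp [cnt]
  | succ n ih =>
    rw [← (Fin.snocEquiv fun i : Fin (n + 1) => Fin (k i)).sum_comp, Fintype.sum_prod_type,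
      cnt, Finset.sum_range]
    refine Finset.sum_congr rfl fun t _ => ?_
    rw [ih]
    refine Finset.sum_congr rfl fun f _ => ?_
    simp only [Fin.snocEquiv_apply, Fin.sum_univ_castSucc, Fin.snoc_castSucc, Fin.snoc_last]
    simp only [le_sub_iff_add_le]

/-- The part of the unit cube where the linear form with coefficients `w` is at most `t`. -/
def slab {n : ℕ} (w : Fin n → ℝ) (t : ℝ) : Set (Fin n → ℝ) :=
  {x | (∀ i, x i ∈ Set.Icc (0 : ℝ) 1) ∧ ∑ i, w i * x i ≤ t}

theorem slab_subset {n : ℕ} (w : Fin n → ℝ) (t : ℝ) : slab w t ⊆ Set.Icc 0 1 :=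
  fun _ hx => ⟨fun i => (hx.1 i).1, fun i => (hx.1 i).2⟩

theorem volume_slab_ne_top {n : ℕ} (w : Fin n → ℝ) (t : ℝ) : volume (slab w t) ≠ ⊤ :=
  ((measure_mono (slab_subset w t)).trans_lt isCompact_Icc.measure_lt_top).ne

theorem isClosed_slab {n : ℕ} (w : Fin n → ℝ) (t : ℝ) : IsClosed (slab w t) := by
  have : slab w t = (⋂ i, {x | x i ∈ Set.Icc (0 : ℝ) 1}) ∩ {x | ∑ i, w i * x i ≤ t} := by
    ext x; simp [slab]
  rw [this]
  refine (isClosed_iInter fun i => isClosed_Icc.preimage (continuous_apply i)).inter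
    (isClosed_le (by fun_prop) continuous_const)

/-- Covering: the index of the box around `x` is at most `k i * x i ≤ w i * x i + 1` in each
coordinate, so the index sum exceeds the linear form by at most `n`. -/
theorem volume_slab_le_cnt {n : ℕ} (w : Fin n → ℝ) (k : ℕ → ℕ) (hk : ∀ i, 1 ≤ k i)
    (hw : ∀ i : Fin n, (k i : ℝ) ≤ w i + 1) (M : ℕ) :
    volume.real (slab w M) ≤ cnt k n (M + n) / ∏ i : Fin n, (k i : ℝ) := by
  let box : (∀ i : Fin n, Fin (k i)) → Set (Fin n → ℝ) := fun f =>
    Set.pi Set.univ fun i => Set.Icc ((f i : ℝ) / k i) (((f i : ℝ) + 1) / k i)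
  have hbox : ∀ f, volume.real (box f) = (∏ i : Fin n, (k i : ℝ))⁻¹ := by
    intro f
    have : box f = Set.Icc (fun i => ((f i : ℝ) / k i)) (fun i => (((f i : ℝ) + 1) / k i)) := by
      simp [box, Set.pi_univ_Icc]
    rw [this, measureReal_def, Real.volume_Icc_pi_toReal]
    · rw [← Finset.prod_inv_distrib]
      refine Finset.prod_congr rfl fun i _ => ?_
      ring
    · intro i
      have : (0 : ℝ) ≤ k i := Nat.cast_nonneg _
      simp only
      gcongr
      linarith
  have hsub : slab w M ⊆ ⋃ f ∈ (Finset.univ.filter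
      fun f : (∀ i : Fin n, Fin (k i)) => ∑ i, ((f i : ℕ) : ℤ) ≤ (M + n : ℤ)), box f := by
    intro x hx
    -- The cap `k i - 1` is needed only for `x i = 1`, where the floor would leave the grid.
    have h0 : ∀ i : Fin n, min ⌊k i * x i⌋₊ (k i - 1) < k i := fun i => by
      have := hk i; omega
    let f : (∀ i : Fin n, Fin (k i)) := fun i => ⟨_, h0 i⟩
    have hk0 : ∀ i : Fin n, (0 : ℝ) < k i := fun i => by exact_mod_cast hk i
    have hf : ∀ i, ((f i : ℕ) : ℝ) ≤ k i * x i := fun i =>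
      (Nat.cast_le.2 (min_le_left _ _)).trans
        (Nat.floor_le (mul_nonneg (hk0 i).le (hx.1 i).1))
    simp only [Finset.mem_filter, Finset.mem_univ, true_and, Set.mem_iUnion, exists_prop]
    refine ⟨f, ?_, fun i _ => ⟨?_, ?_⟩⟩
    · have : (∑ i, ((f i : ℕ) : ℝ)) ≤ M + n := by
        calc (∑ i, ((f i : ℕ) : ℝ)) ≤ ∑ i, (w i * x i + 1) := by
              refine Finset.sum_le_sum fun i _ => (hf i).trans ?_
              nlinarith [hw i, (hx.1 i).1, (hx.1 i).2]
          _ = ∑ i, w i * x i + n := by simp [Finset.sum_add_distrib]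
          _ ≤ M + n := by linarith [hx.2]
      exact_mod_cast this
    · rw [div_le_iff₀ (hk0 i)]; linarith [hf i]
    · rw [le_div_iff₀ (hk0 i)]
      rcases le_total ⌊k i * x i⌋₊ (k i - 1) with h | h
      · have : ((f i : ℕ) : ℝ) = ⌊k i * x i⌋₊ := by simp [f, h]
        rw [this]
        linarith [Nat.lt_floor_add_one (k i * x i)]
      · have : ((f i : ℕ) : ℝ) = k i - 1 := by
          simp only [f, min_eq_right h]
          rw [Nat.cast_sub (hk i)]; simp
        rw [this]
        nlinarith [hk0 i, (hx.1 i).2]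
  calc volume.real (slab w M) ≤ _ := measureReal_mono hsub (by
        refine ((measure_biUnion_finset_le _ _).trans_lt ?_).ne
        refine ENNReal.sum_lt_top.2 fun f _ => ?_
        exact (isCompact_univ_pi fun i => isCompact_Icc).measure_lt_top)
    _ ≤ _ := measureReal_biUnion_finset_le _ _
    _ = _ := by
        simp only [hbox, Finset.sum_const, nsmul_eq_mul, ← cnt_eq_card]
        rw [div_eq_mul_inv]

/-- Packing: in a box with index `f` one has `w i * x i ≤ k i * x i < f i + 1`, which costs another
`n`. The boxes are half-open here, so that they are disjoint and their volumes add up. -/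
theorem cnt_le_volume_slab {n : ℕ} (w : Fin n → ℝ) (k : ℕ → ℕ) (hk : ∀ i, 1 ≤ k i)
    (hw : ∀ i : Fin n, w i ≤ k i) (M : ℕ) :
    cnt k n (M + n) / ∏ i : Fin n, (k i : ℝ) ≤ volume.real (slab w (M + 2 * n)) := by
  let box : (∀ i : Fin n, Fin (k i)) → Set (Fin n → ℝ) := fun f =>
    Set.pi Set.univ fun i => Set.Ico ((f i : ℝ) / k i) (((f i : ℝ) + 1) / k i)
  have hk0 : ∀ i : Fin n, (0 : ℝ) < k i := fun i => by exact_mod_cast hk i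
  have hbox : ∀ f, volume.real (box f) = (∏ i : Fin n, (k i : ℝ))⁻¹ := by
    intro f
    rw [measureReal_def, Real.volume_pi_Ico_toReal]
    · rw [← Finset.prod_inv_distrib]
      refine Finset.prod_congr rfl fun i _ => ?_
      ring
    · intro i
      have := hk0 i
      simp only
      gcongr
      linarith
  have hmem : ∀ f x, x ∈ box f → ∀ i, (f i : ℝ) ≤ k i * x i ∧ k i * x i < f i + 1 := by
    intro f x hx i
    obtain ⟨h1, h2⟩ := hx i trivial
    rw [div_le_iff₀ (hk0 i)] at h1
    rw [lt_div_iff₀ (hk0 i)] at h2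
    constructor <;> linarith
  have hdisj : ∀ f g, f ≠ g → Disjoint (box f) (box g) := by
    intro f g hfg
    refine Set.disjoint_left.2 fun x hx hy => hfg ?_
    funext i
    obtain ⟨h1, h2⟩ := hmem f x hx i
    obtain ⟨h3, h4⟩ := hmem g x hy i
    have a1 : (f i : ℝ) < g i + 1 := by linarith
    have a2 : (g i : ℝ) < f i + 1 := by linarith
    norm_cast at a1 a2
    exact Fin.ext (by omega)
  have hsub : (⋃ f ∈ (Finset.univ.filter
      fun f : (∀ i : Fin n, Fin (k i)) => ∑ i, ((f i : ℕ) : ℤ) ≤ (M + n : ℤ)), box f) ⊆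
      slab w (M + 2 * n) := by
    intro x hx
    simp only [Finset.mem_filter, Finset.mem_univ, true_and, Set.mem_iUnion, exists_prop] at hx
    obtain ⟨f, hf, hx⟩ := hx
    have hx' := hmem f x hx
    have hx0 : ∀ i, 0 ≤ x i := fun i => by
      have := (hx' i).1
      have h2 : (0 : ℝ) ≤ (f i : ℕ) := Nat.cast_nonneg _
      by_contra! h
      nlinarith [hk0 i]
    refine ⟨fun i => ⟨hx0 i, ?_⟩, ?_⟩
    · have h1 := (hx' i).2
      have h2 : ((f i : ℕ) : ℝ) + 1 ≤ k i := by exact_mod_cast (f i).2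
      by_contra! h
      nlinarith [hk0 i]
    · have hf' : (∑ i, ((f i : ℕ) : ℝ)) ≤ M + n := by exact_mod_cast hf
      calc ∑ i, w i * x i ≤ ∑ i, (((f i : ℕ) : ℝ) + 1) := by
            refine Finset.sum_le_sum fun i _ => ?_
            nlinarith [hw i, hx0 i, (hx' i).2]
        _ = ∑ i, ((f i : ℕ) : ℝ) + n := by simp [Finset.sum_add_distrib]
        _ ≤ M + 2 * n := by linarith
  calc _ = ∑ f ∈ (Finset.univ.filter
      fun f : (∀ i : Fin n, Fin (k i)) => ∑ i, ((f i : ℕ) : ℤ) ≤ (M + n : ℤ)),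
        volume.real (box f) := by
        simp only [hbox, Finset.sum_const, nsmul_eq_mul, ← cnt_eq_card]
        rw [div_eq_mul_inv]
    _ = _ := (measureReal_biUnion_finset (fun f _ g _ h => hdisj f g h)
        (fun f _ => MeasurableSet.univ_pi fun i => measurableSet_Ico)
        (fun f _ => by
          rw [Real.volume_pi_Ico]
          exact (ENNReal.prod_lt_top fun i _ => ENNReal.ofReal_lt_top).ne)).symm
    _ ≤ _ := measureReal_mono hsub (volume_slab_ne_top _ _)

/-- Shrinking by `c ≥ 1` keeps a point in the cube and divides the linear form by `c`, so the larger
slab lies in the `c`-fold dilate of the smaller one. -/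
theorem volume_slab_mul_le {n : ℕ} (w : Fin n → ℝ) (t c : ℝ) (hc : 1 ≤ c) :
    volume.real (slab w (c * t)) ≤ c ^ n * volume.real (slab w t) := by
  have hc0 : 0 < c := by linarith
  have hsub : slab w (c * t) ⊆ c • slab w t := by
    intro x hx
    refine ⟨c⁻¹ • x, ⟨fun i => ⟨?_, ?_⟩, ?_⟩, by simp [smul_smul, hc0.ne']⟩
    · exact mul_nonneg (by positivity) (hx.1 i).1
    · have := (hx.1 i).2
      simp only [Pi.smul_apply, smul_eq_mul]
      rw [inv_mul_le_iff₀ hc0]; linarith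
    · have : ∑ i, w i * (c⁻¹ • x) i = c⁻¹ * ∑ i, w i * x i := by
        rw [Finset.mul_sum]
        exact Finset.sum_congr rfl fun i _ => by simp; ring
      rw [this, inv_mul_le_iff₀ hc0]
      exact hx.2
  have h := Measure.addHaar_smul (volume : Measure (Fin n → ℝ)) c (slab w t)
  have h2 : volume.real (c • slab w t) = c ^ n * volume.real (slab w t) := by
    rw [measureReal_def, h, ENNReal.toReal_mul, measureReal_def]
    simp only [Module.finrank_fintype_fun_eq_card, Fintype.card_fin]
    rw [abs_of_pos (by positivity), ENNReal.toReal_ofReal (by positivity)]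
  rw [← h2]
  refine measureReal_mono hsub ?_
  rw [h]
  exact ENNReal.mul_ne_top ENNReal.ofReal_ne_top (volume_slab_ne_top _ _)

theorem polytope_eq_slab {n : ℕ} (a : Fin n → ℤ) (b : ℤ) :
    polytope a b = slab (fun i => (a i : ℝ)) b := rfl

/-- Reflecting the coordinates with negative coefficients makes all coefficients nonnegative. -/
theorem vol_eq_vol_abs {n : ℕ} (a : Fin n → ℤ) (b : ℤ) :
    vol a b = vol (fun i => |a i|) (b + ∑ i, (if a i < 0 then -a i else 0)) := by
  have hp : MeasurePreserving
      (fun (x : Fin n → ℝ) i => (if a i < 0 then (fun y => 1 - y) else id : ℝ → ℝ) (x i)) := by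
    refine volume_preserving_pi fun i => ?_
    split_ifs
    · exact Measure.measurePreserving_sub_left volume 1
    · exact MeasurePreserving.id _
  unfold vol
  rw [measureReal_def, measureReal_def]
  congr 1
  rw [polytope_eq_slab (fun i => |a i|), ← hp.measure_preimage (isClosed_slab _ _).measurableSet.nullMeasurableSet]
  congr 1
  ext x
  simp only [polytope, slab, Set.mem_ofPred_eq, Set.mem_preimage]
  refine and_congr (forall_congr' fun i => ?_) ?_
  · split_ifs
    · simp only [Set.mem_Icc]; constructor <;> rintro ⟨h1, h2⟩ <;> constructor <;> linarith
    · rfl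
  · push_cast
    rw [← sub_nonneg, ← sub_nonneg (b := ∑ i, _)]
    rw [add_sub_assoc, ← Finset.sum_sub_distrib, sub_eq_add_neg, ← Finset.sum_neg_distrib]
    have : ∀ i, ((if a i < 0 then -(a i : ℝ) else 0) - |(a i : ℝ)| *
        (if a i < 0 then (fun y => 1 - y) else id : ℝ → ℝ) (x i)) = -(a i * x i) := by
      intro i
      split_ifs with h
      · rw [abs_of_neg (by exact_mod_cast h)]; ring
      · rw [abs_of_nonneg (by push Not at h; exact_mod_cast h)]; simp
    simp only [this]

theorem vol_eq_slab {n : ℕ} (a : Fin n → ℤ) (b : ℤ) (hb : 0 < b) (M : ℕ) (hM : 0 < M) :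
    vol a b = volume.real (slab (fun i => (a i * M / b : ℝ)) M) := by
  unfold vol
  congr 1
  ext x
  have hb' : (0 : ℝ) < b := by exact_mod_cast hb
  have hM' : (0 : ℝ) < M := by exact_mod_cast hM
  simp only [polytope, slab, Set.mem_ofPred_eq]
  refine and_congr Iff.rfl ?_
  have : ∑ i, (a i * M / b : ℝ) * x i = (∑ i, (a i : ℝ) * x i) * (M / b) := by
    rw [Finset.sum_mul]
    exact Finset.sum_congr rfl fun i _ => by ring
  rw [this, ← le_div_iff₀ (by positivity), div_div_cancel₀ hM'.ne']

theorem vol_of_neg {n : ℕ} (a : Fin n → ℤ) (ha : ∀ i, 0 ≤ a i) (b : ℤ) (hb : b < 0) :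
    vol a b = 0 := by
  have : polytope a b = ∅ := by
    ext x
    simp only [polytope, Set.mem_ofPred_eq, Set.mem_empty_iff_false, iff_false, not_and, not_le]
    intro hx
    have h0 : (0 : ℝ) ≤ ∑ i, (a i : ℝ) * x i := Finset.sum_nonneg fun i _ =>
      mul_nonneg (by exact_mod_cast ha i) (hx i).1
    have : (b : ℝ) < 0 := by exact_mod_cast hb
    linarith
  simp [vol, this]

/-- A positive coefficient forces its coordinate to vanish, which leaves a null set. -/
theorem vol_zero {n : ℕ} (a : Fin n → ℤ) (ha : ∀ i, 0 ≤ a i) (hs : 0 < ∑ i, a i) :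
    vol a 0 = 0 := by
  obtain ⟨j, -, hj⟩ : ∃ j ∈ Finset.univ, 0 < a j := by
    by_contra! h
    exact absurd (Finset.sum_nonpos h) (not_le.2 hs)
  have hsub : polytope a 0 ⊆ Set.pi Set.univ fun i => if i = j then {0} else Set.univ := by
    intro x hx i _
    dsimp only
    split_ifs with h
    · subst h
      have h1 : (a i : ℝ) * x i ≤ ∑ i, (a i : ℝ) * x i :=
        Finset.single_le_sum (f := fun i => (a i : ℝ) * x i)
          (fun i _ => mul_nonneg (by exact_mod_cast ha i) (hx.1 i).1) (Finset.mem_univ i)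
      have h2 := hx.2
      have h3 : (0 : ℝ) < a i := by exact_mod_cast hj
      have h4 := (hx.1 i).1
      simp only [Int.cast_zero] at h2
      exact le_antisymm (by by_contra! h; nlinarith) h4
    · trivial
  have h0 : volume (Set.pi Set.univ fun i => if i = j then ({0} : Set ℝ) else Set.univ) = 0 := by
    rw [volume_pi, Measure.pi_pi]
    exact Finset.prod_eq_zero (Finset.mem_univ j) (by simp)
  rw [vol, measureReal_def, measure_mono_null hsub h0]
  rfl

/-- In both cases the inequality is void on the cube. -/
theorem vol_eq_of_sum_le {n : ℕ} (a : Fin n → ℤ) (ha : ∀ i, 0 ≤ a i) (b c : ℤ)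
    (hb : ∑ i, a i ≤ b) (hc : ∑ i, a i ≤ c) : vol a b = vol a c := by
  have key : ∀ d : ℤ, ∑ i, a i ≤ d → polytope a d = {x | ∀ i, x i ∈ Set.Icc (0 : ℝ) 1} := by
    intro d hd
    ext x
    simp only [polytope, Set.mem_ofPred_eq, and_iff_left_iff_imp]
    intro hx
    calc ∑ i, (a i : ℝ) * x i ≤ ∑ i, (a i : ℝ) := Finset.sum_le_sum fun i _ =>
          mul_le_of_le_one_right (by exact_mod_cast ha i) (hx i).2
      _ ≤ d := by exact_mod_cast hd
  rw [vol, vol, key b hb, key c hc]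

/-- The volume is sandwiched by a count of integer points. -/
theorem vol_le_cnt_le {n : ℕ} (a : Fin n → ℤ) (b : ℤ) (hb : 0 < b) (M : ℕ)
    (hM : 0 < M) (k : ℕ → ℕ) (hk : ∀ i, 1 ≤ k i)
    (hka : ∀ i : Fin n, (k i : ℤ) = a i * M / b + 1) :
    vol a b ≤ cnt k n (M + n) / ∏ i : Fin n, (k i : ℝ) ∧
    cnt k n (M + n) / ∏ i : Fin n, (k i : ℝ) ≤ (1 + 2 * n / M) ^ n * vol a b := by
  have hb' : (0 : ℝ) < b := by exact_mod_cast hb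
  have hM' : (0 : ℝ) < M := by exact_mod_cast hM
  have h1 : ∀ i : Fin n, (k i : ℝ) ≤ a i * M / b + 1 := fun i => by
    have h := Int.ediv_mul_le (a i * M) hb.ne'
    have h2 : ((a i * M / b : ℤ) : ℝ) * b ≤ a i * M := by exact_mod_cast h
    have h3 : (k i : ℝ) = ((a i * M / b : ℤ) : ℝ) + 1 := by exact_mod_cast hka i
    rw [h3]
    gcongr
    rwa [le_div_iff₀ hb']
  have h2 : ∀ i : Fin n, (a i * M / b : ℝ) ≤ k i := fun i => by
    have h := Int.lt_ediv_add_one_mul_self (a i * M) hb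
    have h2 : (a i : ℝ) * M < (((a i * M / b : ℤ) : ℝ) + 1) * b := by exact_mod_cast h
    have h3 : (k i : ℝ) = ((a i * M / b : ℤ) : ℝ) + 1 := by exact_mod_cast hka i
    rw [h3, div_le_iff₀ hb']
    exact h2.le
  rw [vol_eq_slab a b hb M hM]
  refine ⟨volume_slab_le_cnt _ k hk h1 M, (cnt_le_volume_slab _ k hk h2 M).trans ?_⟩
  -- The dilation factor is chosen so that `(1 + 2 n / M) * M = M + 2 n`.
  have := volume_slab_mul_le (fun i => (a i * M / b : ℝ)) M (1 + 2 * n / M)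
    (by have : (0 : ℝ) ≤ 2 * n / M := by positivity
        linarith)
  rwa [add_mul, one_mul, div_mul_cancel₀ _ hM'.ne'] at this


/-! ### Floating-point arithmetic with upward rounding. -/

/-- The normalized floating-point number `m * 2 ^ e` with a mantissa of `q + 1` bits, give or take
one, is an upper approximation of `v`, after `d` roundings. -/
structure Approx (q d : ℕ) (v : ℝ) (m e : ℤ) : Prop where
  lower : 2 ^ q ≤ 2 * m
  upper : m < 2 * 2 ^ q
  le : v ≤ m * (2 : ℝ) ^ e
  ge : m * (2 : ℝ) ^ e ≤ v * (1 + 2 / 2 ^ q) ^ d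

/-- An array cell holds either zero or a normalized number with a small exponent. -/
def Cell (q d : ℕ) (v : ℝ) (m e : ℤ) : Prop :=
  v = 0 ∧ m = 0 ∧ e = 0 ∨ Approx q d v m e ∧ 0 ≤ e ∧ e ≤ d

/-- The table of powers of two, with zeros outside of the range. -/
def powTable (q : ℕ) (j : ℤ) : ℤ := if 0 ≤ j ∧ j ≤ q then 2 ^ j.toNat else 0

theorem one_le_roundFactor (q : ℕ) : (1 : ℝ) ≤ 1 + 2 / 2 ^ q := by
  have : (0 : ℝ) ≤ 2 / 2 ^ q := by positivity
  linarith

theorem Approx.nonneg {q d : ℕ} {v : ℝ} {m e : ℤ} (h : Approx q d v m e) : 0 < m := by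
  have := h.lower
  have : (0 : ℤ) < 2 ^ q := by positivity
  linarith

theorem Approx.value_pos {q d : ℕ} {v : ℝ} {m e : ℤ} (h : Approx q d v m e) : 0 < v := by
  have h1 := h.ge
  have h2 : (0 : ℝ) < m := by exact_mod_cast h.nonneg
  have h3 : 0 < m * (2 : ℝ) ^ e := by positivity
  by_contra! hv
  have : v * (1 + 2 / 2 ^ q) ^ d ≤ 0 := mul_nonpos_of_nonpos_of_nonneg hv (by positivity)
  linarith

theorem Approx.mono {q d d' : ℕ} {v : ℝ} {m e : ℤ} (h : Approx q d v m e) (hd : d ≤ d') :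
    Approx q d' v m e :=
  ⟨h.lower, h.upper, h.le, h.ge.trans (mul_le_mul_of_nonneg_left
    (pow_le_pow_right₀ (one_le_roundFactor q) hd) h.value_pos.le)⟩

theorem Cell.mono {q d d' : ℕ} {v : ℝ} {m e : ℤ} (h : Cell q d v m e) (hd : d ≤ d') :
    Cell q d' v m e := by
  rcases h with h | ⟨h, h0, h1⟩
  · exact Or.inl h
  · exact Or.inr ⟨h.mono hd, h0, h1.trans (by exact_mod_cast hd)⟩

theorem Cell.mantissa_nonneg {q d : ℕ} {v : ℝ} {m e : ℤ} (h : Cell q d v m e) : 0 ≤ m := by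
  rcases h with h | ⟨h, -⟩
  · exact h.2.1.ge
  · exact h.nonneg.le

theorem Cell.mantissa_lt {q d : ℕ} {v : ℝ} {m e : ℤ} (h : Cell q d v m e) : m < 2 * 2 ^ q := by
  rcases h with h | ⟨h, -⟩
  · rw [h.2.1]; positivity
  · exact h.upper

theorem Cell.exponent_nonneg {q d : ℕ} {v : ℝ} {m e : ℤ} (h : Cell q d v m e) : 0 ≤ e := by
  rcases h with h | ⟨_, h, _⟩
  · exact h.2.2.ge
  · exact h

theorem Cell.exponent_le {q d : ℕ} {v : ℝ} {m e : ℤ} (h : Cell q d v m e) : e ≤ d := by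
  rcases h with h | ⟨_, _, h⟩
  · rw [h.2.2]; positivity
  · exact h

theorem Cell.le {q d : ℕ} {v : ℝ} {m e : ℤ} (h : Cell q d v m e) : v ≤ m * (2 : ℝ) ^ e := by
  rcases h with h | ⟨h, _⟩
  · simp [h.1, h.2.1]
  · exact h.le

theorem Cell.ge {q d : ℕ} {v : ℝ} {m e : ℤ} (h : Cell q d v m e) :
    m * (2 : ℝ) ^ e ≤ v * (1 + 2 / 2 ^ q) ^ d := by
  rcases h with h | ⟨h, _⟩
  · simp [h.1, h.2.1]
  · exact h.ge

theorem Cell.approx {q d : ℕ} {v : ℝ} {m e : ℤ} (h : Cell q d v m e) (hv : 0 < v) :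
    Approx q d v m e := by
  rcases h with h | h
  · exact absurd h.1 hv.ne'
  · exact h.1

theorem powTable_zero (q : ℕ) : powTable q 0 = 1 := by simp [powTable]

theorem powTable_nonneg (q : ℕ) (j : ℤ) : 0 ≤ powTable q j := by
  unfold powTable; split_ifs <;> positivity

theorem powTable_le (q : ℕ) (j : ℤ) : powTable q j ≤ 2 ^ q := by
  unfold powTable
  split_ifs with h
  · exact pow_le_pow_right₀ (by norm_num) (by omega)
  · positivity

/-- Shifting a mantissa to a larger exponent. -/
theorem shift_bounds {q : ℕ} {m e e' : ℤ} (h0 : 0 ≤ m) (hm : m < 2 * 2 ^ q) (he : e' ≤ e) :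
    (m : ℝ) * 2 ^ e' ≤ ((m / powTable q (e - e') : ℤ) + 1) * (2 : ℝ) ^ e ∧
    ((m / powTable q (e - e') : ℤ)) * (2 : ℝ) ^ e ≤ m * (2 : ℝ) ^ e' := by
  obtain ⟨j, hj⟩ := Int.eq_ofNat_of_zero_le (sub_nonneg.2 he)
  have hee : (2 : ℝ) ^ e = 2 ^ j * 2 ^ e' := by
    rw [show e = j + e' by omega, zpow_add₀ (by norm_num), zpow_natCast]
  have hpos : (0 : ℝ) < 2 ^ e' := by positivity
  rw [hj, hee, ← mul_assoc, ← mul_assoc]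
  rcases le_or_gt j q with h | h
  · have hp : powTable q j = 2 ^ j := by simp [powTable, h]
    rw [hp]
    have hpj : (0 : ℤ) < 2 ^ j := by positivity
    have h1 := Int.lt_ediv_add_one_mul_self m hpj
    have h2 := Int.ediv_mul_le m hpj.ne'
    constructor
    · refine mul_le_mul_of_nonneg_right ?_ hpos.le
      exact_mod_cast h1.le
    · refine mul_le_mul_of_nonneg_right ?_ hpos.le
      exact_mod_cast h2
  -- A shift beyond the table divides by zero, which returns `0`. This is the correct quotient,
  -- because the mantissa is below `2 ^ (q + 1) ≤ 2 ^ j`.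
  · have hp : powTable q j = 0 := by simp [powTable, h]
    rw [hp, Int.ediv_zero]
    constructor
    · refine mul_le_mul_of_nonneg_right ?_ hpos.le
      have : (2 : ℤ) * 2 ^ q ≤ 2 ^ j := by
        rw [← pow_succ']; exact pow_le_pow_right₀ (by norm_num) h
      simp only [Int.cast_zero, zero_add, one_mul]
      exact_mod_cast hm.le.trans this
    · simp only [Int.cast_zero, zero_mul]
      have : (0 : ℝ) ≤ m := by exact_mod_cast h0
      positivity

theorem ediv_powTable_bounds {q : ℕ} {m : ℤ} (j : ℤ) (h0 : 0 ≤ m) :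
    0 ≤ m / powTable q j ∧ m / powTable q j ≤ m :=
  ⟨Int.ediv_nonneg h0 (powTable_nonneg q j), Int.ediv_le_self _ h0⟩

/-- Truncating the smaller summand loses less than one unit `2 ^ e`, and the `+ 1` restores an upper
bound. As `m ≥ 2 ^ q / 2`, this unit is at most the fraction `2 / 2 ^ q` of the larger summand. -/
theorem round_of_exponent_ge {q d : ℕ} {u v : ℝ} {m m' e e' : ℤ} (hu : Approx q d u m e)
    (hv : Cell q d v m' e') (he : e' ≤ e) :
    u + v ≤ ((m + m' / powTable q (e - e') + 1 : ℤ) : ℝ) * 2 ^ e ∧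
    ((m + m' / powTable q (e - e') + 1 : ℤ) : ℝ) * 2 ^ e ≤
      (u + v) * (1 + 2 / 2 ^ q) ^ (d + 1) := by
  obtain ⟨h1, h2⟩ := shift_bounds hv.mantissa_nonneg hv.mantissa_lt he
  have h3 := hu.le
  have h4 := hu.ge
  have h5 := hv.le
  have h6 := hv.ge
  push_cast
  refine ⟨by linarith, ?_⟩
  have h7 : (2 : ℝ) ^ q ≤ 2 * m := by exact_mod_cast hu.lower
  have hq : (0 : ℝ) < 2 ^ q := by positivity
  have h8 : (1 : ℝ) ≤ 2 / 2 ^ q * m := by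
    rw [div_mul_eq_mul_div, le_div_iff₀ hq]; linarith
  have he0 : (0 : ℝ) < 2 ^ e := by positivity
  have h9 : (2 : ℝ) ^ e ≤ 2 / 2 ^ q * (m * 2 ^ e) := by nlinarith
  have h10 : (0 : ℝ) ≤ m' * 2 ^ e' := by
    have : (0 : ℝ) ≤ m' := by exact_mod_cast hv.mantissa_nonneg
    positivity
  have h11 : (0 : ℝ) ≤ 2 / 2 ^ q := by positivity
  calc ((m : ℝ) + (m' / powTable q (e - e') : ℤ) + 1) * 2 ^ e
      ≤ (m * 2 ^ e + m' * 2 ^ e') * (1 + 2 / 2 ^ q) := by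
        nlinarith [mul_nonneg h11 h10]
    _ ≤ ((u + v) * (1 + 2 / 2 ^ q) ^ d) * (1 + 2 / 2 ^ q) := by
        refine mul_le_mul_of_nonneg_right ?_ (by positivity)
        linarith
    _ = _ := by ring

/-- Adding two floating-point numbers, before normalization. -/
theorem Cell.add {q d : ℕ} {u v : ℝ} {m m' e e' f : ℤ} (hu : Cell q d u m e)
    (hv : Cell q d v m' e') (hpos : 0 < u + v) (hf : f = max e e') :
    let s := m / powTable q (f - e) + m' / powTable q (f - e') + 1
    2 ^ q ≤ 2 * s ∧ s ≤ 4 * 2 ^ q ∧ u + v ≤ s * (2 : ℝ) ^ f ∧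
      s * (2 : ℝ) ^ f ≤ (u + v) * (1 + 2 / 2 ^ q) ^ (d + 1) := by
  intro s
  have hu0 := hu.mantissa_nonneg
  have hv0 := hv.mantissa_nonneg
  have hu1 := hu.mantissa_lt
  have hv1 := hv.mantissa_lt
  have a1 := ediv_powTable_bounds (q := q) (f - e) hu0
  have a2 := ediv_powTable_bounds (q := q) (f - e') hv0
  have key1 : ∀ h : Approx q d u m e, e' ≤ e → _ := fun h he => round_of_exponent_ge h hv he
  have key2 : ∀ h : Approx q d v m' e', e ≤ e' → _ := fun h he => round_of_exponent_ge h hu he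
  have t1 : Approx q d u m e → e' ≤ e → 2 ^ q ≤ 2 * s ∧ s ≤ 4 * 2 ^ q ∧ u + v ≤ s * (2 : ℝ) ^ f ∧
      s * (2 : ℝ) ^ f ≤ (u + v) * (1 + 2 / 2 ^ q) ^ (d + 1) := by
    intro h he
    have hfe : f = e := by rw [hf, max_eq_left he]
    have hs : s = m + m' / powTable q (e - e') + 1 := by
      simp only [s, hfe, sub_self, powTable_zero, Int.ediv_one]
    have := key1 h he
    rw [hfe] at a2
    have hl := h.lower
    rw [hs, hfe]
    exact ⟨by linarith, by linarith, this⟩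
  have t2 : Approx q d v m' e' → e ≤ e' → 2 ^ q ≤ 2 * s ∧ s ≤ 4 * 2 ^ q ∧
      u + v ≤ s * (2 : ℝ) ^ f ∧ s * (2 : ℝ) ^ f ≤ (u + v) * (1 + 2 / 2 ^ q) ^ (d + 1) := by
    intro h he
    have hfe : f = e' := by rw [hf, max_eq_right he]
    have hs : s = m' + m / powTable q (e' - e) + 1 := by
      simp only [s, hfe, sub_self, powTable_zero, Int.ediv_one]; ring
    have := key2 h he
    rw [hfe] at a1
    have hl := h.lower
    rw [hs, hfe, add_comm u v]
    exact ⟨by linarith, by linarith, this⟩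
  -- A zero cell has exponent `0` and the other exponents are nonnegative, so the maximal exponent
  -- can always be attributed to a nonzero cell.
  rcases hu with ⟨hu, _, hue⟩ | ⟨hu, hue, _⟩
  · rcases hv with ⟨hv, _, hve⟩ | ⟨hv, hve, _⟩
    · rw [hu, hv] at hpos; simp at hpos
    · exact t2 hv (by omega)
  · rcases hv with ⟨hv, _, hve⟩ | ⟨hv, hve, _⟩
    · exact t1 hu (by omega)
    · rcases le_total e e' with h | h
      · exact t2 hv h
      · exact t1 hu h

/-- Normalization divides a large mantissa by four. -/
theorem approx_normalize {q d : ℕ} {v : ℝ} {m e : ℤ} (hq : 1 ≤ q) (h1 : 2 ^ q ≤ 2 * m)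
    (h2 : m ≤ 4 * 2 ^ q) (h3 : v ≤ m * (2 : ℝ) ^ e)
    (h4 : m * (2 : ℝ) ^ e ≤ v * (1 + 2 / 2 ^ q) ^ d) :
    Approx q (d + 1) v (if 2 * 2 ^ q ≤ m then m / 4 + 1 else m)
      (if 2 * 2 ^ q ≤ m then e + 2 else e) := by
  have hQ : (2 : ℤ) ≤ 2 ^ q := by
    calc (2 : ℤ) = 2 ^ 1 := by norm_num
      _ ≤ 2 ^ q := pow_le_pow_right₀ (by norm_num) hq
  have he0 : (0 : ℝ) < 2 ^ e := by positivity
  have hmpos : (0 : ℝ) < m := by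
    have : 0 < m := by linarith
    exact_mod_cast this
  have hv : 0 ≤ v := by
    by_contra! hv
    have h5 : 0 < m * (2 : ℝ) ^ e := by positivity
    have : v * (1 + 2 / 2 ^ q) ^ d ≤ 0 := mul_nonpos_of_nonpos_of_nonneg hv.le (by positivity)
    linarith
  -- Four rather than two: the mantissa can be as large as `4 * 2 ^ q`, and half of that plus one
  -- would still exceed the admissible range.
  split_ifs with h
  · have e2 : (2 : ℝ) ^ (e + 2) = 4 * 2 ^ e := by
      rw [zpow_add₀ (by norm_num)]; norm_num [mul_comm]
    have b1 : m < 4 * (m / 4 + 1) := by omega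
    have b2 : 4 * (m / 4 + 1) ≤ m + 4 := by omega
    have b1' : (m : ℝ) < 4 * ((m / 4 + 1 : ℤ) : ℝ) := by exact_mod_cast b1
    have b2' : 4 * ((m / 4 + 1 : ℤ) : ℝ) ≤ m + 4 := by exact_mod_cast b2
    have hq0 : (0 : ℝ) < 2 ^ q := by positivity
    have hm2 : (2 : ℝ) * 2 ^ q ≤ m := by exact_mod_cast h
    have b3 : (m : ℝ) + 4 ≤ m * (1 + 2 / 2 ^ q) := by
      have : (4 : ℝ) ≤ m * (2 / 2 ^ q) := by
        rw [mul_div_assoc', le_div_iff₀ hq0]; linarith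
      linarith
    refine ⟨by omega, by omega, ?_, ?_⟩
    · rw [e2]
      nlinarith
    · rw [e2, pow_succ, ← mul_assoc v]
      calc ((m / 4 + 1 : ℤ) : ℝ) * (4 * 2 ^ e) ≤ (m * 2 ^ e) * (1 + 2 / 2 ^ q) := by nlinarith
        _ ≤ _ := mul_le_mul_of_nonneg_right h4 (by positivity)
  · push Not at h
    exact ⟨h1, h, h3, h4.trans (mul_le_mul_of_nonneg_left
      (pow_le_pow_right₀ (one_le_roundFactor q) (Nat.le_succ d)) hv)⟩

/-- Dividing a floating-point number by an integer, before normalization. -/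
theorem Approx.div {q d : ℕ} {v : ℝ} {m e k : ℤ} {c : ℕ} (h : Approx q d v m e) (hk : 0 < k)
    (h1 : k ≤ 2 ^ c) (h2 : 2 ^ c < 2 * k) :
    2 ^ q ≤ 2 * (m * 2 ^ c / k + 1) ∧ m * 2 ^ c / k + 1 ≤ 4 * 2 ^ q ∧
      v / k ≤ ((m * 2 ^ c / k + 1 : ℤ) : ℝ) * 2 ^ (e - c) ∧
      ((m * 2 ^ c / k + 1 : ℤ) : ℝ) * 2 ^ (e - c) ≤ v / k * (1 + 2 / 2 ^ q) ^ (d + 1) := by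
  have hm := h.nonneg
  have hl := h.lower
  have hu := h.upper
  -- Since `k ≤ 2 ^ c < 2 * k`, the quotient stays between `m` and `2 * m`, so no precision is lost.
  have a1 : m ≤ m * 2 ^ c / k := by
    rw [Int.le_ediv_iff_mul_le hk]; nlinarith
  have a2 : m * 2 ^ c / k < 2 * m := by
    rw [Int.ediv_lt_iff_lt_mul hk]; nlinarith
  have a3 := Int.lt_ediv_add_one_mul_self (m * 2 ^ c) hk
  have a4 := Int.ediv_mul_le (m * 2 ^ c) hk.ne'
  have a3' : (m : ℝ) * 2 ^ c < ((m * 2 ^ c / k + 1 : ℤ) : ℝ) * k := by exact_mod_cast a3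
  have a4' : ((m * 2 ^ c / k : ℤ) : ℝ) * k ≤ (m : ℝ) * 2 ^ c := by exact_mod_cast a4
  have hk' : (0 : ℝ) < k := by exact_mod_cast hk
  have hee : (2 : ℝ) ^ e = 2 ^ c * 2 ^ (e - c) := by
    rw [← zpow_natCast, ← zpow_add₀ (by norm_num)]; congr 1; ring
  have hp : (0 : ℝ) < 2 ^ (e - c) := by positivity
  have h5 := h.le
  have h6 := h.ge
  rw [hee] at h5 h6
  refine ⟨by linarith, by omega, ?_, ?_⟩
  · rw [div_le_iff₀ hk']
    nlinarith
  · rw [div_mul_eq_mul_div, le_div_iff₀ hk', pow_succ, ← mul_assoc]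
    have h7 : (2 : ℝ) ^ q ≤ 2 * m := by exact_mod_cast hl
    have hq : (0 : ℝ) < 2 ^ q := by positivity
    have h8 : (1 : ℝ) ≤ 2 / 2 ^ q * m := by
      rw [div_mul_eq_mul_div, le_div_iff₀ hq]; linarith
    have h1' : (k : ℝ) ≤ 2 ^ c := by exact_mod_cast h1
    have h9 : (k : ℝ) ≤ 2 / 2 ^ q * m * 2 ^ c := by
      calc (k : ℝ) ≤ 1 * 2 ^ c := by linarith
        _ ≤ _ := mul_le_mul_of_nonneg_right h8 (by positivity)
    calc ((m * 2 ^ c / k + 1 : ℤ) : ℝ) * 2 ^ (e - c) * k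
        = (((m * 2 ^ c / k : ℤ) : ℝ) * k + k) * 2 ^ (e - c) := by push_cast; ring
      _ ≤ (m * 2 ^ c + 2 / 2 ^ q * m * 2 ^ c) * 2 ^ (e - c) :=
          mul_le_mul_of_nonneg_right (by linarith) hp.le
      _ = m * (2 ^ c * 2 ^ (e - c)) * (1 + 2 / 2 ^ q) := by ring
      _ ≤ _ := mul_le_mul_of_nonneg_right h6 (by positivity)

/-! ### Window sums -/

theorem cnt_of_neg (k : ℕ → ℕ) (n : ℕ) (y : ℤ) (hy : y < 0) : cnt k n y = 0 := by
  induction n generalizing y with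
  | zero => simp [cnt, hy]
  | succ n ih =>
    rw [cnt]
    exact Finset.sum_eq_zero fun t _ => ih _ (by omega)

/-- The sum of the last `l` values of `f` up to `y`. -/
def window (f : ℤ → ℝ) (l : ℕ) (y : ℤ) : ℝ := ∑ t ∈ Finset.range l, f (y - t)

/-- The identity behind both uses of the table addition: equal lengths double a window, and
different lengths append a binary digit. -/
theorem window_add (f : ℤ → ℝ) (l l' : ℕ) (y : ℤ) :
    window f (l + l') y = window f l y + window f l' (y - l) := by
  unfold window
  rw [Finset.sum_range_add]
  congr 1
  refine Finset.sum_congr rfl fun t _ => ?_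
  congr 1; push_cast; ring

theorem window_zero (f : ℤ → ℝ) (y : ℤ) : window f 0 y = 0 := by simp [window]

theorem window_one (f : ℤ → ℝ) (y : ℤ) : window f 1 y = f y := by simp [window]

theorem window_pos {f : ℤ → ℝ} (hf : ∀ y, 0 ≤ f y) (hf' : ∀ y, 0 ≤ y → 0 < f y) {l : ℕ}
    (hl : 0 < l) {y : ℤ} (hy : 0 ≤ y) : 0 < window f l y :=
  Finset.sum_pos' (fun _ _ => hf _) ⟨0, by simpa using hl, by simpa using hf' y hy⟩

theorem window_of_neg {f : ℤ → ℝ} (hf : ∀ y < 0, f y = 0) (l : ℕ) {y : ℤ} (hy : y < 0) :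
    window f l y = 0 := Finset.sum_eq_zero fun _ _ => hf _ (by omega)

/-- Terms beyond the first `Y + 1` have a negative argument. Thus an exponentially large `k i` can
be cut down to the table size. -/
theorem window_min {f : ℤ → ℝ} (hf : ∀ y < 0, f y = 0) (l : ℕ) {Y : ℕ} {y : ℤ} (hy : y ≤ Y) :
    window f (min l (Y + 1)) y = window f l y := by
  rcases le_total l (Y + 1) with h | h
  · rw [min_eq_left h]
  · rw [min_eq_right h]
    obtain ⟨j, rfl⟩ := Nat.exists_eq_add_of_le h
    rw [window_add f (Y + 1) j, window_of_neg hf j (by push_cast; omega), add_zero]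

/-- The factor `c` will be `2 ^ q`, so that the initial count `1` is stored with a normalized
mantissa and exponent zero. -/
theorem window_cnt (k : ℕ → ℕ) (i : ℕ) (c : ℝ) (y : ℤ) :
    window (fun y => c * cnt k i y) (k i) y = c * cnt k (i + 1) y := by
  simp [window, cnt, Finset.mul_sum]

/-- The zero vector is always counted. Rounded addition adds a positive unit, so it is sound only at
arguments where the exact sum is positive. -/
theorem cnt_pos (k : ℕ → ℕ) (hk : ∀ i, 1 ≤ k i) (n : ℕ) (y : ℤ) (hy : 0 ≤ y) :
    0 < cnt k n y := by
  induction n with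
  | zero => simp [cnt, hy]
  | succ n ih =>
    exact Finset.sum_pos' (fun _ _ => Nat.zero_le _) ⟨0, Finset.mem_range.2 (hk n), by simpa using ih⟩


/-! ### Evaluation rules, bit bounds and frame conditions. -/

instance : Add Expr := ⟨.bin .add⟩
instance : Sub Expr := ⟨.bin .sub⟩
instance : Mul Expr := ⟨.bin .mul⟩
instance : Div Expr := ⟨.bin .div⟩

@[simp] theorem Expr.eval_add (σ : State) (e f : Expr) : (e + f).eval σ = e.eval σ + f.eval σ := rfl
@[simp] theorem Expr.eval_sub (σ : State) (e f : Expr) : (e - f).eval σ = e.eval σ - f.eval σ := rfl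
@[simp] theorem Expr.eval_mul (σ : State) (e f : Expr) : (e * f).eval σ = e.eval σ * f.eval σ := rfl
@[simp] theorem Expr.eval_div (σ : State) (e f : Expr) : (e / f).eval σ = e.eval σ / f.eval σ := rfl
@[simp] theorem Expr.eval_lit (σ : State) (c : ℤ) : (Expr.lit c).eval σ = c := rfl
@[simp] theorem Expr.eval_var (σ : State) (x : ℕ) : (Expr.var x).eval σ = σ.var x := rfl
@[simp] theorem Expr.eval_get (σ : State) (A : ℕ) (e : Expr) :
    (Expr.get A e).eval σ = σ.arr A (e.eval σ) := rfl
@[simp] theorem Expr.eval_lt (σ : State) (e f : Expr) :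
    (Expr.bin .lt e f).eval σ = if e.eval σ < f.eval σ then 1 else 0 := rfl
@[simp] theorem Expr.eval_le (σ : State) (e f : Expr) :
    (Expr.bin .le e f).eval σ = if e.eval σ ≤ f.eval σ then 1 else 0 := rfl

@[simp] theorem Expr.cost_add (e f : Expr) : (e + f).cost = e.cost + f.cost + 1 := rfl
@[simp] theorem Expr.cost_sub (e f : Expr) : (e - f).cost = e.cost + f.cost + 1 := rfl
@[simp] theorem Expr.cost_mul (e f : Expr) : (e * f).cost = e.cost + f.cost + 1 := rfl
@[simp] theorem Expr.cost_div (e f : Expr) : (e / f).cost = e.cost + f.cost + 1 := rfl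
@[simp] theorem Expr.cost_lit (c : ℤ) : (Expr.lit c).cost = 1 := rfl
@[simp] theorem Expr.cost_var (x : ℕ) : (Expr.var x).cost = 1 := rfl
@[simp] theorem Expr.cost_get (A : ℕ) (e : Expr) : (Expr.get A e).cost = e.cost + 1 := rfl
@[simp] theorem Expr.cost_bin (o : Op) (e f : Expr) :
    (Expr.bin o e f).cost = e.cost + f.cost + 1 := rfl

/-- The integers with at most `B` bits. -/
def Small (B : ℕ) (z : ℤ) : Prop := -2 ^ B < z ∧ z < 2 ^ B

/-- Turns bit lengths into two linear inequalities, the form in which all size conditions are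
checked. -/
theorem bitLength_le_iff {B : ℕ} {z : ℤ} : bitLength z ≤ B ↔ Small B z := by
  rw [bitLength, Nat.clog_le_iff_le_pow one_lt_two, Nat.succ_le_iff, Small, ← abs_lt,
    ← Nat.cast_lt (α := ℤ), Int.natCast_natAbs]
  push_cast
  rfl

@[simp] theorem Expr.fits_add {B : ℕ} {σ : State} {e f : Expr} : (e + f).Fits B σ ↔
    e.Fits B σ ∧ f.Fits B σ ∧ Small B (e.eval σ + f.eval σ) := by
  rw [← bitLength_le_iff]; rfl
@[simp] theorem Expr.fits_sub {B : ℕ} {σ : State} {e f : Expr} : (e - f).Fits B σ ↔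
    e.Fits B σ ∧ f.Fits B σ ∧ Small B (e.eval σ - f.eval σ) := by
  rw [← bitLength_le_iff]; rfl
@[simp] theorem Expr.fits_mul {B : ℕ} {σ : State} {e f : Expr} : (e * f).Fits B σ ↔
    e.Fits B σ ∧ f.Fits B σ ∧ Small B (e.eval σ * f.eval σ) := by
  rw [← bitLength_le_iff]; rfl
@[simp] theorem Expr.fits_div {B : ℕ} {σ : State} {e f : Expr} : (e / f).Fits B σ ↔
    e.Fits B σ ∧ f.Fits B σ ∧ Small B (e.eval σ / f.eval σ) := by
  rw [← bitLength_le_iff]; rfl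
@[simp] theorem Expr.fits_lt {B : ℕ} {σ : State} {e f : Expr} : (Expr.bin .lt e f).Fits B σ ↔
    e.Fits B σ ∧ f.Fits B σ ∧ Small B (if e.eval σ < f.eval σ then 1 else 0) := by
  rw [← bitLength_le_iff]; rfl
@[simp] theorem Expr.fits_le {B : ℕ} {σ : State} {e f : Expr} : (Expr.bin .le e f).Fits B σ ↔
    e.Fits B σ ∧ f.Fits B σ ∧ Small B (if e.eval σ ≤ f.eval σ then 1 else 0) := by
  rw [← bitLength_le_iff]; rfl
@[simp] theorem Expr.fits_var {B : ℕ} {σ : State} {x : ℕ} :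
    (Expr.var x).Fits B σ ↔ Small B (σ.var x) := by
  rw [← bitLength_le_iff]; rfl
@[simp] theorem Expr.fits_lit {B : ℕ} {σ : State} {c : ℤ} :
    (Expr.lit c).Fits B σ ↔ Small B c := by
  rw [← bitLength_le_iff]; rfl
@[simp] theorem Expr.fits_get {B : ℕ} {σ : State} {A : ℕ} {e : Expr} :
    (Expr.get A e).Fits B σ ↔ e.Fits B σ ∧ Small B (σ.arr A (e.eval σ)) := by
  rw [← bitLength_le_iff]; rfl

@[simp] theorem State.var_setVar (σ : State) (x y : ℕ) (v : ℤ) :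
    (σ.setVar x v).var y = if y = x then v else σ.var y := Function.update_apply _ _ _ _
@[simp] theorem State.arr_setVar (σ : State) (x : ℕ) (v : ℤ) : (σ.setVar x v).arr = σ.arr := rfl
@[simp] theorem State.var_setArr (σ : State) (A : ℕ) (i v : ℤ) : (σ.setArr A i v).var = σ.var := rfl
@[simp] theorem State.arr_setArr (σ : State) (A A' : ℕ) (i v : ℤ) :
    (σ.setArr A i v).arr A' = if A' = A then Function.update (σ.arr A) i v else σ.arr A' :=
  Function.update_apply _ _ _ _

theorem State.setVar_self (σ : State) (x : ℕ) : σ.setVar x (σ.var x) = σ := by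
  simp [State.setVar]

/-- `Agree V A σ τ`: the memories differ at most in the variables in `V` and the arrays in `A`. -/
def Agree (V A : List ℕ) (σ τ : State) : Prop :=
  (∀ x, x ∉ V → τ.var x = σ.var x) ∧ ∀ x, x ∉ A → τ.arr x = σ.arr x

theorem Agree.refl (V A : List ℕ) (σ : State) : Agree V A σ σ := ⟨fun _ _ => rfl, fun _ _ => rfl⟩

theorem Agree.trans {V A : List ℕ} {σ τ υ : State} (h : Agree V A σ τ) (h' : Agree V A τ υ) :
    Agree V A σ υ :=
  ⟨fun x hx => (h'.1 x hx).trans (h.1 x hx), fun x hx => (h'.2 x hx).trans (h.2 x hx)⟩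

theorem Agree.mono {V A V' A' : List ℕ} {σ τ : State} (h : Agree V A σ τ) (hV : V ⊆ V')
    (hA : A ⊆ A') : Agree V' A' σ τ :=
  ⟨fun x hx => h.1 x fun h => hx (hV h), fun x hx => h.2 x fun h => hx (hA h)⟩

theorem Agree.setVar {V A : List ℕ} {σ τ : State} (h : Agree V A σ τ) {x : ℕ} (hx : x ∈ V) (v : ℤ) :
    Agree V A σ (τ.setVar x v) :=
  ⟨fun y hy => by rw [State.var_setVar, if_neg (fun h : y = x => hy (h ▸ hx)), h.1 y hy], h.2⟩

theorem Agree.setArr {V A : List ℕ} {σ τ : State} (h : Agree V A σ τ) {x : ℕ} (hx : x ∈ A)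
    (i v : ℤ) : Agree V A σ (τ.setArr x i v) :=
  ⟨h.1, fun y hy => by rw [State.arr_setArr, if_neg (fun h : y = x => hy (h ▸ hx)), h.2 y hy]⟩

/-! ### Total-correctness rules with time and bit bounds. -/

/-- Sequential composition of a list of programs. -/
def Prog.block : List Prog → Prog
  | [] => .skip
  | p :: ps => .seq p (.block ps)

/-- Started in `σ`, the program halts after at most `T` operations in a memory that satisfies `Q`,
and it handles no number of more than `B` bits. -/
def Runs (B : ℕ) (p : Prog) (σ : State) (T : ℕ) (Q : State → Prop) : Prop :=
  ∃ t τ, Exec B p σ t τ ∧ t ≤ T ∧ Q τ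

namespace Runs

variable {B T T' : ℕ} {p q : Prog} {ps : List Prog} {e c : Expr} {σ : State} {Q R : State → Prop}

theorem mono (h : Runs B p σ T Q) (hT : T ≤ T') (hQ : ∀ τ, Q τ → R τ) : Runs B p σ T' R := by
  obtain ⟨t, τ, h, ht, hq⟩ := h
  exact ⟨t, τ, h, ht.trans hT, hQ τ hq⟩

theorem skip (h : Q σ) : Runs B .skip σ T Q := ⟨0, σ, .skip σ, Nat.zero_le _, h⟩

theorem nil (h : Q σ) : Runs B (.block []) σ T Q := skip h

theorem seq (hp : Runs B p σ T R) (hT : T ≤ T')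
    (hq : ∀ τ, R τ → Runs B q τ (T' - T) Q) : Runs B (.seq p q) σ T' Q := by
  obtain ⟨t, τ, h, ht, hr⟩ := hp
  obtain ⟨t', υ, h', ht', hq⟩ := hq τ hr
  exact ⟨t + t', υ, .seq _ _ _ _ _ _ _ h h', by omega, hq⟩

theorem cons (hp : Runs B p σ T R) (hT : T ≤ T')
    (hq : ∀ τ, R τ → Runs B (.block ps) τ (T' - T) Q) : Runs B (.block (p :: ps)) σ T' Q :=
  seq hp hT hq

theorem set {x : ℕ} (hf : e.Fits B σ) (hT : e.cost + 1 ≤ T) (h : Q (σ.setVar x (e.eval σ))) :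
    Runs B (.set x e) σ T Q := ⟨_, _, .set x e σ hf, hT, h⟩

theorem put {A : ℕ} {i : Expr} (hi : i.Fits B σ) (hf : e.Fits B σ)
    (hT : i.cost + e.cost + 1 ≤ T) (h : Q (σ.setArr A (i.eval σ) (e.eval σ))) :
    Runs B (.put A i e) σ T Q := ⟨_, _, .put A i e σ hi hf, hT, h⟩

/-- The assigned value is passed on as a variable with an equation, so that it can be simplified
before the rest of the program is treated. -/
theorem set_cons {x : ℕ} (hf : e.Fits B σ) (hT : e.cost + 1 ≤ T)
    (h : ∀ v, v = e.eval σ → Runs B (.block ps) (σ.setVar x v) (T - (e.cost + 1)) Q) :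
    Runs B (.block (.set x e :: ps)) σ T Q :=
  cons (R := fun τ => τ = σ.setVar x (e.eval σ)) (set hf le_rfl rfl) hT fun τ hτ => by
    subst hτ; exact h _ rfl

theorem put_cons {A : ℕ} {i : Expr} (hi : i.Fits B σ) (hf : e.Fits B σ)
    (hT : i.cost + e.cost + 1 ≤ T)
    (h : Runs B (.block ps) (σ.setArr A (i.eval σ) (e.eval σ)) (T - (i.cost + e.cost + 1)) Q) :
    Runs B (.block (.put A i e :: ps)) σ T Q :=
  cons (R := fun τ => τ = σ.setArr A (i.eval σ) (e.eval σ)) (put hi hf le_rfl rfl) hT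
    fun τ hτ => by subst hτ; exact h

theorem cond (hc : c.Fits B σ) (hT : c.cost + 1 ≤ T)
    (hp : c.eval σ ≠ 0 → Runs B p σ (T - (c.cost + 1)) Q)
    (hq : c.eval σ = 0 → Runs B q σ (T - (c.cost + 1)) Q) : Runs B (.cond c p q) σ T Q := by
  by_cases h : c.eval σ = 0
  · obtain ⟨t, τ, h', ht, hr⟩ := hq h
    exact ⟨_, τ, .cond_false _ _ _ _ _ _ hc h h', by omega, hr⟩
  · obtain ⟨t, τ, h', ht, hr⟩ := hp h
    exact ⟨_, τ, .cond_true _ _ _ _ _ _ hc h h', by omega, hr⟩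

/-- A conditional assignment. -/
theorem condSet_cons {x : ℕ} (hc : c.Fits B σ) (hf : c.eval σ ≠ 0 → e.Fits B σ)
    (hT : c.cost + e.cost + 2 ≤ T)
    (h : ∀ v, v = (if c.eval σ ≠ 0 then e.eval σ else σ.var x) →
      Runs B (.block ps) (σ.setVar x v) (T - (c.cost + e.cost + 2)) Q) :
    Runs B (.block (.cond c (.set x e) .skip :: ps)) σ T Q := by
  refine cons (T := c.cost + e.cost + 2)
    (R := fun τ => τ = σ.setVar x (if c.eval σ ≠ 0 then e.eval σ else σ.var x)) ?_ hT
    fun τ hτ => by subst hτ; exact h _ rfl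
  refine cond hc (by omega) (fun h => ?_) (fun h => ?_)
  · exact set (hf h) (by omega) (by rw [if_pos h])
  · exact skip (by rw [if_neg (not_not.2 h), State.setVar_self])

/-- The index of the invariant bounds the number of remaining iterations. At index zero `hstep` is
contradictory if the condition still holds; leaving early is allowed. -/
theorem loop {t : ℕ} (I : ℕ → State → Prop) (k : ℕ) (h0 : I k σ)
    (hc : ∀ k σ, I k σ → c.Fits B σ)
    (hstep : ∀ k σ, I k σ → c.eval σ ≠ 0 → ∃ k', k = k' + 1 ∧ Runs B p σ t (I k'))
    (hT : (k + 1) * (t + c.cost + 1) ≤ T) (hQ : ∀ k τ, I k τ → c.eval τ = 0 → Q τ) :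
    Runs B (.loop c p) σ T Q := by
  suffices ∀ k σ, I k σ → Runs B (.loop c p) σ ((k + 1) * (t + c.cost + 1)) Q from
    (this k σ h0).mono hT fun _ h => h
  intro k
  induction k with
  | zero =>
    intro σ h
    by_cases he : c.eval σ = 0
    · exact ⟨_, _, .loop_false _ _ _ (hc _ _ h) he, by nlinarith, hQ _ _ h he⟩
    · obtain ⟨k', hk, -⟩ := hstep _ _ h he
      omega
  | succ k ih =>
    intro σ h
    by_cases he : c.eval σ = 0
    · exact ⟨_, _, .loop_false _ _ _ (hc _ _ h) he, by nlinarith, hQ _ _ h he⟩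
    · obtain ⟨k', hk, t', τ, hr, ht, hI⟩ := hstep _ _ h he
      obtain rfl : k = k' := by omega
      obtain ⟨t'', υ, hr', ht', hq⟩ := ih τ hI
      exact ⟨_, υ, .loop_true _ _ _ _ _ _ _ (hc _ _ h) he hr hr', by nlinarith, hq⟩

/-- A loop that counts the variable `y` down to zero. -/
theorem countdown {t y k : ℕ} (I : ℕ → State → Prop) (hy : σ.var y = k) (h0 : I k σ)
    (hB : (k : ℤ) + 1 < 2 ^ B)
    (hstep : ∀ j τ, j < k → I (j + 1) τ →
      Runs B (.block ps) (τ.setVar y j) t fun υ => υ.var y = j ∧ I j υ)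
    (hT : (k + 1) * (t + 6) ≤ T) (hQ : ∀ τ, τ.var y = 0 → I 0 τ → Q τ) :
    Runs B (.loop (.var y) (.block (.set y (.var y - .lit 1) :: ps))) σ T Q := by
  refine loop (t := t + 4) (fun j τ => τ.var y = j ∧ j ≤ k ∧ I j τ) k ⟨hy, le_rfl, h0⟩ ?_ ?_ ?_ ?_
  · rintro j τ ⟨h1, h2, -⟩
    simp only [Expr.fits_var, Small, h1]
    constructor <;> omega
  · rintro j τ ⟨h1, h2, h3⟩ hne
    simp only [Expr.eval_var, h1] at hne
    obtain ⟨j', rfl⟩ : ∃ j', j = j' + 1 := ⟨j - 1, by omega⟩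
    refine ⟨j', rfl, set_cons ?_ (by simp) ?_⟩
    · simp only [Expr.fits_sub, Expr.fits_var, Expr.eval_var, Expr.eval_lit, Expr.fits_lit,
        Small, h1]
      push_cast
      refine ⟨⟨?_, ?_⟩, ⟨?_, ?_⟩, ?_, ?_⟩ <;> omega
    · rintro v rfl
      have : (Expr.var y - .lit 1).eval τ = j' := by
        rw [Expr.eval_sub, Expr.eval_var, Expr.eval_lit, h1]; push_cast; ring
      rw [this]
      exact (hstep j' τ (by omega) h3).mono (by simp) fun υ hυ => ⟨hυ.1, by omega, hυ.2⟩
  · simpa [add_assoc] using hT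
  · rintro j τ ⟨h1, h2, h3⟩ h
    simp only [Expr.eval_var, h1] at h
    obtain rfl : j = 0 := by omega
    exact hQ τ (by simpa using h1) h3

/-- A loop that counts the variable `y` up from zero to the value of the variable `z`. -/
theorem countup {t y z k : ℕ} (I : ℕ → State → Prop) (hy : σ.var y = 0) (h0 : I 0 σ)
    (hz : ∀ j τ, I j τ → τ.var z = (k : ℤ)) (hB : (k : ℤ) + 1 < 2 ^ B)
    (hstep : ∀ j τ, j < k → τ.var y = (j : ℤ) → I j τ → Runs B p τ t fun υ =>
      υ.var y = (j : ℤ) ∧ I (j + 1) (υ.setVar y (j + 1)))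
    (hT : (k + 1) * (t + 8) ≤ T) (hQ : ∀ τ, I k τ → Q τ) :
    Runs B (.loop (.bin .lt (.var y) (.var z)) (.seq p (.set y (.var y + .lit 1)))) σ T Q := by
  -- The index of `loop` counts down, so the counter and the invariant are taken at `k - j`.
  refine loop (t := t + 4) (fun j τ => j ≤ k ∧ τ.var y = ((k - j : ℕ) : ℤ) ∧ I (k - j) τ) k
    ⟨le_rfl, by simpa using hy, by simpa using h0⟩ ?_ ?_ ?_ ?_
  · rintro j τ ⟨h1, h2, h3⟩
    simp only [Expr.fits_lt, Expr.fits_var, Small, h2, hz _ _ h3, Expr.eval_var]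
    refine ⟨by omega, by omega, ?_⟩
    split_ifs <;> omega
  · rintro j τ ⟨h1, h2, h3⟩ hne
    simp only [Expr.eval_lt, Expr.eval_var, h2, hz _ _ h3] at hne
    have hj : j ≠ 0 := by rintro rfl; simp at hne
    obtain ⟨j', rfl⟩ : ∃ j', j = j' + 1 := ⟨j - 1, by omega⟩
    refine ⟨j', rfl, seq (hstep _ τ (by omega) h2 h3) (Nat.le_add_right _ _) ?_⟩
    rintro υ ⟨h4, h5⟩
    refine set ?_ (by simp) ⟨by omega, ?_, ?_⟩
    · simp only [Expr.fits_add, Expr.fits_var, Expr.eval_var, Expr.eval_lit, Expr.fits_lit,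
        Small, h4]
      refine ⟨⟨?_, ?_⟩, ⟨?_, ?_⟩, ?_, ?_⟩ <;> omega
    · simp only [Expr.eval_add, Expr.eval_var, Expr.eval_lit, h4, State.var_setVar, if_true]
      omega
    · have : (Expr.var y + .lit 1).eval υ = ((k - (j' + 1) : ℕ) : ℤ) + 1 := by
        rw [Expr.eval_add, Expr.eval_var, Expr.eval_lit, h4]
      rw [this]
      convert h5 using 1
      omega
  · simpa [add_assoc] using hT
  · rintro j τ ⟨h1, h2, h3⟩ h
    simp only [Expr.eval_lt, Expr.eval_var, h2, hz _ _ h3] at h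
    have : j = 0 := by
      by_contra hj
      rw [if_pos (by omega)] at h
      omega
    subst this
    exact hQ τ (by simpa using h3)

end Runs


/-! ### Table addition and window sums. -/

/-- `D[y] := D[y] + S[y - o]` for all `y ≤ Y`, in floating-point arithmetic. The mantissas and
exponents are in the arrays `dm`, `de` and `sm`, `se`, the offset is in the variable `o`. -/
def addLoop (dm de sm se o : ℕ) : Prog := .block [
  .set 15 (.var 8 + .lit 1),
  .loop (.var 15) (.block [
    .set 15 (.var 15 - .lit 1),
    .set 16 (.get de (.var 15)),
    .cond (.bin .lt (.var 16) (.get se (.var 15 - .var o)))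
      (.set 16 (.get se (.var 15 - .var o))) .skip,
    .set 17 (.get dm (.var 15) / .get 5 (.var 16 - .get de (.var 15)) +
      .get sm (.var 15 - .var o) / .get 5 (.var 16 - .get se (.var 15 - .var o)) + .lit 1),
    .cond (.bin .le (.lit 2 * .var 9) (.var 17)) (.set 16 (.var 16 + .lit 2)) .skip,
    .cond (.bin .le (.lit 2 * .var 9) (.var 17)) (.set 17 (.var 17 / .lit 4 + .lit 1)) .skip,
    .put dm (.var 15) (.var 17),
    .put de (.var 15) (.var 16)])]

/-- The cells of the arrays `A` (mantissas) and `A'` (exponents) up to `Y` approximate `f`. -/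
def Cells (q d Y : ℕ) (f : ℤ → ℝ) (A A' : ℤ → ℤ) : Prop :=
  ∀ y : ℤ, y ≤ Y → Cell q d (f y) (A y) (A' y)

/-- The descending order permits source and target to coincide: entry `y - off` with `off ≥ 0` is
read before it is overwritten. The `+ 2` in `d + 2` stands for one rounding in the sum and one in
the normalization. -/
theorem runs_addLoop {B q d Y o off dm de sm se : ℕ} {u v : ℤ → ℝ} {σ : State}
    (hq : 1 ≤ q) (hB : (16 : ℤ) * 2 ^ q < 2 ^ B) (hY : (Y : ℤ) + 2 ≤ 2 ^ q)
    (hoff : (off : ℤ) ≤ 2 ^ q) (hd : (d : ℤ) + 2 ≤ 2 ^ q)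
    (h8 : σ.var 8 = Y) (h9 : σ.var 9 = 2 ^ q) (ho : σ.var o = off) (ho' : o ∉ [15, 16, 17])
    (h5 : σ.arr 5 = powTable q) (hD : dm ≠ de) (hdm : dm ≠ 5) (hde : de ≠ 5)
    (hS : sm = dm ∧ se = de ∨ (sm ≠ dm ∧ sm ≠ de) ∧ se ≠ dm ∧ se ≠ de)
    (hu : Cells q d Y u (σ.arr dm) (σ.arr de)) (hv : Cells q d Y v (σ.arr sm) (σ.arr se))
    (hpos : ∀ y, 0 ≤ y → 0 < u y + v (y - off))
    (hneg : ∀ y < 0, u y = 0 ∧ v y = 0) :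
    Runs B (addLoop dm de sm se o) σ ((Y + 2) * 80 + 10) fun τ =>
      Agree [15, 16, 17] [dm, de] σ τ ∧
      Cells q (d + 2) Y (fun y => u y + v (y - off)) (τ.arr dm) (τ.arr de) := by
  have hQ : (2 : ℤ) ≤ 2 ^ q := by
    calc (2 : ℤ) = 2 ^ 1 := by norm_num
      _ ≤ 2 ^ q := pow_le_pow_right₀ (by norm_num) hq
  have hoff0 : (0 : ℤ) ≤ off := Int.natCast_nonneg _
  have hd0 : (0 : ℤ) ≤ d := Int.natCast_nonneg _
  have hY0 : (0 : ℤ) ≤ Y := Int.natCast_nonneg _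
  refine Runs.set_cons ?_ (by simp) fun w hw => ?_
  · simp only [Expr.fits_add, Expr.fits_var, Expr.fits_lit, Expr.eval_var, Expr.eval_lit, h8]
    and_intros <;> linarith
  replace hw : w = (Y + 1 : ℕ) := by simpa [h8] using hw
  subst hw
  -- Invariant: indices below `j` still hold the old entries, indices from `j` to `Y` hold the sums.
  refine Runs.cons (T := (Y + 1 + 1) * (74 + 6)) (Runs.countdown (t := 74)
    (fun j τ => Agree [15, 16, 17] [dm, de] σ τ ∧
      (∀ z : ℤ, z < j → τ.arr dm z = σ.arr dm z ∧ τ.arr de z = σ.arr de z) ∧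
      ∀ z : ℤ, j ≤ z → z ≤ Y → Cell q (d + 2) (u z + v (z - off)) (τ.arr dm z) (τ.arr de z))
    (k := Y + 1) (by simp) ⟨?_, fun _ _ => ⟨rfl, rfl⟩, ?_⟩ (by push_cast; linarith) ?_ le_rfl
    (Q := fun τ => Agree [15, 16, 17] [dm, de] σ τ ∧
      Cells q (d + 2) Y (fun y => u y + v (y - off)) (τ.arr dm) (τ.arr de)) ?_)
    (by simp) fun τ h => .nil h
  · exact (Agree.refl _ _ _).setVar (by simp) _
  · intro z h1 h2
    push_cast at h1
    linarith
  · rintro j τ hj ⟨hA, hlt, hge⟩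
    have hj0 : (0 : ℤ) ≤ j := Int.natCast_nonneg _
    have hjY : (j : ℤ) ≤ Y := by exact_mod_cast Nat.lt_succ_iff.1 hj
    have ht8 : τ.var 8 = Y := (hA.1 8 (by simp)).trans h8
    have ht9 : τ.var 9 = 2 ^ q := (hA.1 9 (by simp)).trans h9
    have hto : τ.var o = off := (hA.1 o ho').trans ho
    have ht5 : τ.arr 5 = powTable q := (hA.2 5 (by simp [hdm.symm, hde.symm])).trans h5
    obtain ⟨hdmj, hdej⟩ := hlt j (by push_cast; linarith)
    have hsrc : τ.arr sm (j - off) = σ.arr sm (j - off) ∧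
        τ.arr se (j - off) = σ.arr se (j - off) := by
      rcases hS with ⟨rfl, rfl⟩ | ⟨⟨h1, h2⟩, h3, h4⟩
      · exact hlt _ (by push_cast; linarith)
      · rw [hA.2 sm (by simp [h1, h2]), hA.2 se (by simp [h3, h4])]
        exact ⟨rfl, rfl⟩
    have c1 := hu j hjY
    have c2 := hv (j - off) (by linarith)
    rw [← hdmj, ← hdej] at c1
    rw [← hsrc.1, ← hsrc.2] at c2
    generalize hm1 : τ.arr dm j = m1 at c1
    generalize he1 : τ.arr de j = e1 at c1
    generalize hm2 : τ.arr sm (j - off) = m2 at c2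
    generalize he2 : τ.arr se (j - off) = e2 at c2
    have b1 := c1.mantissa_nonneg
    have b2 := c1.mantissa_lt
    have b3 := c1.exponent_nonneg
    have b4 := c1.exponent_le
    have b5 := c2.mantissa_nonneg
    have b6 := c2.mantissa_lt
    have b7 := c2.exponent_nonneg
    have b8 := c2.exponent_le
    have hop : o ≠ 15 ∧ o ≠ 16 ∧ o ≠ 17 := by simpa using ho'
    refine Runs.set_cons ?_ (by simp) fun e he => ?_
    · simp [he1, Small]
      and_intros <;> linarith
    replace he : e = e1 := by simpa [he1] using he
    subst he
    refine Runs.condSet_cons ?_ (fun _ => ?_) (by simp) fun e' he' => ?_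
    · simp [hop, hto, he2, Small]
      and_intros <;> (try split_ifs) <;> linarith
    · simp [hop, hto, he2, Small]
      and_intros <;> linarith
    replace he' : e' = max e e2 := by
      simp [hop, hto, he2] at he'
      rw [he']
      rcases lt_or_ge e e2 with h | h
      · rw [if_pos h, max_eq_right h.le]
      · rw [if_neg h.not_gt, max_eq_left h]
    have b9 : 0 ≤ e' := he' ▸ b3.trans (le_max_left _ _)
    have b10 : e' ≤ d := he' ▸ max_le b4 b8
    have b11 : e ≤ e' := he' ▸ le_max_left _ _
    have b12 : e2 ≤ e' := he' ▸ le_max_right _ _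
    obtain ⟨g1, g2, g3, g4⟩ := c1.add c2 (hpos j hj0) he'
    have a1 := ediv_powTable_bounds (q := q) (e' - e) b1
    have a2 := ediv_powTable_bounds (q := q) (e' - e2) b5
    have a3 := powTable_nonneg q (e' - e)
    have a4 := powTable_nonneg q (e' - e2)
    have a5 := powTable_le q (e' - e)
    have a6 := powTable_le q (e' - e2)
    refine Runs.set_cons ?_ (by simp) fun m hm => ?_
    · simp [hop, hto, hm1, he1, hm2, he2, ht5, Small]
      and_intros <;> linarith
    replace hm : m = m1 / powTable q (e' - e) + m2 / powTable q (e' - e2) + 1 := by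
      simpa [hop, hto, hm1, he1, hm2, he2, ht5] using hm
    rw [← hm] at g1 g2 g3 g4
    clear hm
    have hn := approx_normalize hq g1 g2 g3 g4
    refine Runs.condSet_cons ?_ (fun _ => ?_) (by simp) fun f hf => ?_
    · simp [ht9, Small]
      and_intros <;> (try split_ifs) <;> linarith
    · simp [Small]
      and_intros <;> linarith
    replace hf : f = if 2 * 2 ^ q ≤ m then e' + 2 else e' := by simpa [ht9] using hf
    refine Runs.condSet_cons ?_ (fun _ => ?_) (by simp) fun m' hm' => ?_
    · simp [ht9, Small]
      and_intros <;> (try split_ifs) <;> linarith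
    · simp [Small]
      and_intros <;> omega
    replace hm' : m' = if 2 * 2 ^ q ≤ m then m / 4 + 1 else m := by simpa [ht9] using hm'
    rw [← hf, ← hm'] at hn
    have n1 := hn.nonneg
    have n2 := hn.upper
    have n3 : e' ≤ f ∧ f ≤ e' + 2 := by rw [hf]; split_ifs <;> constructor <;> linarith
    have hcell : Cell q (d + 2) (u j + v (j - off)) m' f :=
      Or.inr ⟨hn, by linarith, by push_cast; linarith⟩
    refine Runs.put_cons ?_ ?_ (by simp) (Runs.put_cons ?_ ?_ (by simp) (Runs.nil ⟨by simp, ?_⟩))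
    · simp [Small]; constructor <;> linarith
    · simp [Small]; constructor <;> linarith
    · simp [Small]; constructor <;> linarith
    · simp [Small]; constructor <;> linarith
    refine ⟨?_, ?_, ?_⟩
    · refine Agree.setArr (Agree.setArr ?_ (by simp) _ _) (by simp) _ _
      iterate 6 refine Agree.setVar ?_ (by simp) _
      exact hA
    · intro z hz
      obtain ⟨h1, h2⟩ := hlt z (by push_cast; linarith)
      simp [hD, hD.symm, Function.update_of_ne hz.ne, h1, h2]
    · intro z hz hzY
      rcases hz.eq_or_lt with rfl | hz
      · simpa [hD, hD.symm] using hcell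
      · have := hge z (by push_cast; linarith) hzY
        simpa [hD, hD.symm, Function.update_of_ne hz.ne'] using this
  · rintro τ _ ⟨hA, hlt, hge⟩
    refine ⟨hA, fun y hy => ?_⟩
    -- Negative indices are never written, and there the shifted summand is zero.
    rcases lt_or_ge y 0 with h | h
    · obtain ⟨h1, h2⟩ := hlt y (by simpa using h)
      rw [h1, h2]
      have : u y + v (y - off) = u y := by rw [(hneg (y - off) (by linarith)).2, add_zero]
      simp only [this]
      exact (hu y hy).mono (by omega)
    · exact hge y (by simpa using h) hy


theorem Cell.eq_zero {q d : ℕ} {v : ℝ} {m e : ℤ} (h : Cell q d v m e) (hv : v = 0) :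
    m = 0 ∧ e = 0 := by
  rcases h with h | h
  · exact h.2
  · exact absurd hv h.1.value_pos.ne'

theorem cell_zero (q d : ℕ) : Cell q d 0 0 0 := Or.inl ⟨rfl, rfl, rfl⟩

theorem Cells.mono {q d d' Y : ℕ} {f : ℤ → ℝ} {A A' : ℤ → ℤ} (h : Cells q d Y f A A')
    (hd : d ≤ d') : Cells q d' Y f A A' := fun y hy => (h y hy).mono hd

/-- `A[y] := e` and `A'[y] := e'` for all `0 ≤ y ≤ Y`, where `e` and `e'` may depend on `y`. -/
def fillLoop (A A' : ℕ) (e e' : Expr) : Prog := .block [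
  .set 15 (.var 8 + .lit 1),
  .loop (.var 15) (.block [
    .set 15 (.var 15 - .lit 1),
    .put A (.var 15) e,
    .put A' (.var 15) e'])]

/-- The hypothesis `he` ranges over all memories that agree outside the targets, because `e'` is
evaluated after the write to `A` and both expressions after earlier iterations. -/
theorem runs_fillLoop {B Y A A' : ℕ} {e e' : Expr} {g g' : ℤ → ℤ} {σ : State} (hA : A ≠ A')
    (hY : (Y : ℤ) + 2 < 2 ^ B) (h8 : σ.var 8 = Y) (hc : e.cost ≤ 2) (hc' : e'.cost ≤ 2)
    (he : ∀ τ (y : ℕ), Agree [15] [A, A'] σ τ → τ.var 15 = y → y ≤ Y →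
      (e.Fits B τ ∧ e.eval τ = g y) ∧ e'.Fits B τ ∧ e'.eval τ = g' y) :
    Runs B (fillLoop A A' e e') σ ((Y + 2) * 14 + 10) fun τ =>
      Agree [15] [A, A'] σ τ ∧
      (∀ y : ℤ, τ.arr A y = if 0 ≤ y ∧ y ≤ Y then g y else σ.arr A y) ∧
      ∀ y : ℤ, τ.arr A' y = if 0 ≤ y ∧ y ≤ Y then g' y else σ.arr A' y := by
  have hY0 : (0 : ℤ) ≤ Y := Int.natCast_nonneg _
  refine Runs.set_cons ?_ (by simp) fun w hw => ?_
  · simp only [Expr.fits_add, Expr.fits_var, Expr.fits_lit, Expr.eval_var, Expr.eval_lit, h8]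
    refine ⟨⟨?_, ?_⟩, ⟨?_, ?_⟩, ?_, ?_⟩ <;> linarith
  replace hw : w = (Y + 1 : ℕ) := by simpa [h8] using hw
  subst hw
  refine Runs.cons (T := (Y + 1 + 1) * (8 + 6)) (Runs.countdown (t := 8)
    (fun j τ => Agree [15] [A, A'] σ τ ∧
      (∀ y : ℤ, τ.arr A y = if j ≤ y ∧ y ≤ Y then g y else σ.arr A y) ∧
      ∀ y : ℤ, τ.arr A' y = if j ≤ y ∧ y ≤ Y then g' y else σ.arr A' y)
    (k := Y + 1) (by simp) ⟨?_, ?_, ?_⟩ (by push_cast; linarith) ?_ le_rfl ?_)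
    (by simp) fun τ h => .nil h
  · exact (Agree.refl _ _ _).setVar (by simp) _
  · intro y
    rw [if_neg (by push_cast; omega)]
    rfl
  · intro y
    rw [if_neg (by push_cast; omega)]
    rfl
  · rintro j τ hj ⟨h1, h2, h3⟩
    obtain ⟨⟨f1, f2⟩, -⟩ := he (τ.setVar 15 j) j (h1.setVar (by simp) _) (by simp) (by omega)
    obtain ⟨-, f3, f4⟩ := he ((τ.setVar 15 j).setArr A j (g j)) j
      ((h1.setVar (by simp) _).setArr (by simp) _ _) (by simp) (by omega)
    have hs : Small B j := ⟨by omega, by omega⟩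
    refine Runs.put_cons (by simpa using hs) f1 (by simp; omega) ?_
    simp only [Expr.eval_var, State.var_setVar, if_true, f2]
    refine Runs.put_cons (by simpa using hs) f3 (by simp; omega) (Runs.nil ⟨by simp, ?_⟩)
    simp only [Expr.eval_var, State.var_setArr, State.var_setVar, if_true, f4]
    refine ⟨((h1.setVar (by simp) _).setArr (by simp) _ _).setArr (by simp) _ _, ?_, ?_⟩
    · intro y
      simp only [State.arr_setArr, State.arr_setVar, if_true, if_neg hA, Function.update_apply]
      rw [h2]
      push_cast
      split_ifs <;> first | rfl | omega | (congr 1; omega)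
    · intro y
      simp only [State.arr_setArr, State.arr_setVar, if_true, if_neg hA.symm, Function.update_apply]
      rw [h3]
      push_cast
      split_ifs <;> first | rfl | omega | (congr 1; omega)
  · rintro τ _ ⟨h1, h2, h3⟩
    exact ⟨h1, by simpa using h2, by simpa using h3⟩

/-- Replaces the function in the arrays `1` and `2` by its window sums of the length in the
variable `11`. The windows of lengths `1, 2, 4, …` are computed in place, and those that belong to
the binary digits of the length are added up in the arrays `3` and `4`. -/
def windowSum : Prog := .block [
  .cond (.bin .lt (.var 8 + .lit 1) (.var 11)) (.set 11 (.var 8 + .lit 1)) .skip,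
  .set 12 (.lit 1),
  .set 13 (.lit 0),
  fillLoop 3 4 (.lit 0) (.lit 0),
  .loop (.var 11) (.block [
    .cond (.var 11 - .lit 2 * (.var 11 / .lit 2))
      (.block [addLoop 3 4 1 2 13, .set 13 (.var 13 + .var 12)]) .skip,
    addLoop 1 2 1 2 12,
    .set 12 (.lit 2 * .var 12),
    .set 11 (.var 11 / .lit 2)]),
  fillLoop 1 2 (.get 3 (.var 15)) (.get 4 (.var 15))]

/-- Binary expansion: each round doubles the window in arrays `1`, `2` and, for an odd remaining
multiplier, first adds it to the accumulator. There are at most `q + 1` rounds, each raising the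
depth by two. Zeros at negative indices of arrays `3`, `4` are required and returned, since
`fillLoop` does not reset them for the next call. -/
theorem runs_windowSum {B q d Y k : ℕ} {f : ℤ → ℝ} {σ : State}
    (hq : 1 ≤ q) (hB : (16 : ℤ) * 2 ^ q < 2 ^ B) (hY : (Y : ℤ) + 2 ≤ 2 ^ q)
    (hd : (d : ℤ) + 2 * (q + 1) ≤ 2 ^ q) (hk : 1 ≤ k) (hkB : (k : ℤ) < 2 ^ B)
    (h8 : σ.var 8 = Y) (h9 : σ.var 9 = 2 ^ q) (h11 : σ.var 11 = k)
    (h5 : σ.arr 5 = powTable q) (hf : Cells q d Y f (σ.arr 1) (σ.arr 2))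
    (hf0 : ∀ y < 0, f y = 0) (hfpos : ∀ y, 0 ≤ y → 0 < f y)
    (h34 : ∀ y < 0, σ.arr 3 y = 0 ∧ σ.arr 4 y = 0) :
    Runs B windowSum σ ((q + 3) * ((Y + 2) * 300)) fun τ =>
      Agree [11, 12, 13, 15, 16, 17] [1, 2, 3, 4] σ τ ∧
      Cells q (d + 2 * (q + 1)) Y (window f k) (τ.arr 1) (τ.arr 2) ∧
      ∀ y < 0, τ.arr 3 y = 0 ∧ τ.arr 4 y = 0 := by
  have hQ : (2 : ℤ) ≤ 2 ^ q := by
    calc (2 : ℤ) = 2 ^ 1 := by norm_num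
      _ ≤ 2 ^ q := pow_le_pow_right₀ (by norm_num) hq
  have hY0 : (0 : ℤ) ≤ Y := Int.natCast_nonneg _
  have hfnn : ∀ y, 0 ≤ f y := fun y => by
    rcases lt_or_ge y 0 with h | h
    · exact (hf0 y h).ge
    · exact (hfpos y h).le
  -- The capped length keeps the offsets below `2 ^ q` and the number of rounds at most `q + 1`.
  obtain ⟨l, hl⟩ : ∃ l, l = min k (Y + 1) := ⟨_, rfl⟩
  have hlY : l ≤ Y + 1 := hl ▸ min_le_right _ _
  have hlpos : 0 < l := by omega
  have hlY' : (l : ℤ) ≤ Y + 1 := by exact_mod_cast hlY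
  have hT : ((Y + 2) * 14 + 10) + (q + 2) * (2 * ((Y + 2) * 80 + 10) + 32) +
      ((Y + 2) * 14 + 10) + 20 ≤ (q + 3) * ((Y + 2) * 300) := by nlinarith
  refine Runs.mono ?_ hT fun _ h => h
  refine Runs.condSet_cons ?_ (fun _ => ?_) (by simp) fun w hw => ?_
  · simp [h8, h11, Small]
    and_intros <;> (try split_ifs) <;> omega
  · simp [h8, Small]
    and_intros <;> omega
  replace hw : w = l := by
    simp [h8, h11] at hw
    rw [hw, hl]
    split_ifs <;> omega
  subst hw
  refine Runs.set_cons (by simp [Small]; and_intros <;> omega) (by simp) fun w hw => ?_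
  replace hw : w = 1 := by simpa using hw
  subst hw
  refine Runs.set_cons (by simp [Small]) (by simp) fun w hw => ?_
  replace hw : w = 0 := by simpa using hw
  subst hw
  refine Runs.cons (runs_fillLoop (Y := Y) (g := fun _ => 0) (g' := fun _ => 0) (by norm_num)
    (by linarith) (by simpa using h8) (by simp) (by simp)
    (fun τ y _ _ _ => by simp [Small])) (by simp; omega) ?_
  rintro τ₀ ⟨hA₀, h3, h4⟩
  have hA : Agree [11, 12, 13, 15, 16, 17] [1, 2, 3, 4] σ τ₀ := by
    refine Agree.trans ?_ (hA₀.mono (by simp) (by simp))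
    iterate 3 refine Agree.setVar ?_ (by simp) _
    exact Agree.refl _ _ _
  -- Invariant `kk * cur + off = l`: the window of length `cur` is in arrays `1`, `2`, the one of
  -- length `off` is accumulated in `3`, `4`, and `kk < 2 ^ r` bounds the remaining rounds by `r`.
  refine Runs.cons (T := (q + 2) * (2 * ((Y + 2) * 80 + 10) + 32)) (R := fun τ =>
      Agree [11, 12, 13, 15, 16, 17] [1, 2, 3, 4] σ τ ∧
      (∃ c, Cells q (d + 2 * (q + 1)) Y (window f c) (τ.arr 1) (τ.arr 2)) ∧
      Cells q (d + 2 * (q + 1)) Y (window f l) (τ.arr 3) (τ.arr 4))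
    (Runs.loop (t := 2 * ((Y + 2) * 80 + 10) + 30) (fun r τ =>
      Agree [11, 12, 13, 15, 16, 17] [1, 2, 3, 4] σ τ ∧
      ∃ kk cur off : ℕ, τ.var 11 = kk ∧ τ.var 12 = cur ∧ τ.var 13 = off ∧ kk < 2 ^ r ∧
        kk * cur + off = l ∧ 0 < cur ∧ cur ≤ 2 * l ∧ r ≤ q + 1 ∧
        Cells q (d + 2 * (q + 1 - r)) Y (window f cur) (τ.arr 1) (τ.arr 2) ∧
        Cells q (d + 2 * (q + 1 - r)) Y (window f off) (τ.arr 3) (τ.arr 4)) (q + 1)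
      ⟨hA, l, 1, 0, ?_, ?_, ?_, ?_, by simp, one_pos, by omega, le_rfl, ?_, ?_⟩ ?_ ?_ ?_ ?_)
      (by simp; omega) ?_
  · rw [hA₀.1 _ (by simp)]; simp
  · rw [hA₀.1 _ (by simp)]; simp
  · rw [hA₀.1 _ (by simp)]; simp
  · have : (l : ℤ) < 2 ^ (q + 1) := by rw [pow_succ]; linarith
    exact_mod_cast this
  · rw [hA₀.2 1 (by simp), hA₀.2 2 (by simp)]
    intro y hy
    rw [window_one]
    exact (hf y hy).mono (by omega)
  · intro y hy
    rw [h3, h4, window_zero]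
    split_ifs with h
    · exact cell_zero _ _
    · have := h34 y (by omega)
      simp only [State.arr_setVar, this]
      exact cell_zero _ _
  · rintro r τ ⟨-, kk, cur, off, h1, h2, h3, h4, h5, h6, h7, h8, -⟩
    have : kk ≤ l := by nlinarith
    simp only [Expr.fits_var, h1, Small]
    omega
  · rintro r τ ⟨hA, kk, cur, off, h1, h2, h3, h4, h5', h6, h7, h8', hT, hR⟩ hne
    have hkk : 0 < kk := by
      rw [Expr.eval_var, h1] at hne
      omega
    have hcur : cur ≤ l := by nlinarith
    have hkl : kk ≤ l := by nlinarith
    obtain ⟨r, rfl⟩ : ∃ r', r = r' + 1 := by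
      refine ⟨r - 1, ?_⟩
      rcases r with _ | r
      · simp at h4; omega
      · simp
    refine ⟨r, rfl, ?_⟩
    -- Both additions of the round take operands of depth `d'`, because the accumulation precedes
    -- the doubling; so a round costs two levels, not four.
    obtain ⟨d', hd'⟩ : ∃ d', d' = d + 2 * (q + 1 - (r + 1)) := ⟨_, rfl⟩
    have hd2 : d + 2 * (q + 1 - r) = d' + 2 := by omega
    rw [← hd'] at hT hR
    have hd3 : (d' : ℤ) + 2 ≤ 2 ^ q := by
      have : (d' : ℤ) + 2 ≤ d + 2 * (q + 1) := by omega
      linarith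
    have ht8 : τ.var 8 = Y := (hA.1 8 (by simp)).trans h8
    have ht9 : τ.var 9 = 2 ^ q := (hA.1 9 (by simp)).trans h9
    have ht5 : τ.arr 5 = powTable q := (hA.2 5 (by simp)).trans h5
    refine Runs.cons (T := (Y + 2) * 80 + 10 + 12) (R := fun υ => Agree [13, 15, 16, 17] [3, 4] τ υ ∧
      ∃ off' : ℕ, υ.var 13 = off' ∧ kk / 2 * (2 * cur) + off' = l ∧
        Cells q (d' + 2) Y (window f off') (υ.arr 3) (υ.arr 4))
      (Runs.cond ?_ (by simp) (fun hc => ?_) (fun hc => ?_)) (by omega) ?_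
    · simp [h1, Small]
      and_intros <;> omega
    · have hodd : kk = 2 * (kk / 2) + 1 := by
        simp [h1] at hc
        omega
      refine Runs.cons (runs_addLoop hq hB hY (off := off) (by omega) hd3 ht8 ht9 h3 (by simp) ht5
        (by norm_num) (by norm_num) (by norm_num) (Or.inr (by norm_num)) hR hT ?_ ?_)
        (by simp) ?_
      · intro y hy
        rw [← window_add]
        exact window_pos hfnn hfpos (by omega) hy
      · exact fun y hy => ⟨window_of_neg hf0 _ hy, window_of_neg hf0 _ hy⟩
      · rintro υ ⟨hA', hc'⟩
        have hu13 : υ.var 13 = off := (hA'.1 13 (by simp)).trans h3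
        have hu12 : υ.var 12 = cur := (hA'.1 12 (by simp)).trans h2
        refine Runs.set_cons ?_ (by simp) fun w hw => Runs.nil ?_
        · simp [hu13, hu12, Small]
          and_intros <;> omega
        replace hw : w = (off + cur : ℕ) := by simpa [hu13, hu12] using hw
        refine ⟨(hA'.mono (by simp) (by simp)).setVar (by simp) _, off + cur, by simp [hw], ?_, ?_⟩
        · rw [hodd] at h5'
          rw [← h5']; ring
        · simp only [← window_add] at hc'
          exact hc'
    · have heven : kk = 2 * (kk / 2) := by
        simp [h1] at hc
        omega
      refine Runs.skip ⟨Agree.refl _ _ _, off, h3, ?_, hR.mono (by omega)⟩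
      rw [heven] at h5'
      rw [← h5']; ring
    · rintro υ ⟨hA', off', hu13, hoff', hR'⟩
      have hu12 : υ.var 12 = cur := (hA'.1 12 (by simp)).trans h2
      have hu11 : υ.var 11 = kk := (hA'.1 11 (by simp)).trans h1
      have hT' : Cells q d' Y (window f cur) (υ.arr 1) (υ.arr 2) := by
        rw [hA'.2 1 (by simp), hA'.2 2 (by simp)]; exact hT
      refine Runs.cons (runs_addLoop hq hB hY (off := cur) (by omega) hd3
        ((hA'.1 8 (by simp)).trans ht8) ((hA'.1 9 (by simp)).trans ht9) hu12 (by simp)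
        ((hA'.2 5 (by simp)).trans ht5)
        (by norm_num) (by norm_num) (by norm_num) (Or.inl ⟨rfl, rfl⟩) hT' hT' ?_ ?_)
        (by omega) ?_
      · intro y hy
        rw [← window_add]
        exact window_pos hfnn hfpos (by omega) hy
      · exact fun y hy => ⟨window_of_neg hf0 _ hy, window_of_neg hf0 _ hy⟩
      · rintro υ' ⟨hA'', hc'⟩
        have hv12 : υ'.var 12 = cur := (hA''.1 12 (by simp)).trans hu12
        have hv11 : υ'.var 11 = kk := (hA''.1 11 (by simp)).trans hu11
        have hv13 : υ'.var 13 = off' := (hA''.1 13 (by simp)).trans hu13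
        refine Runs.set_cons ?_ (by simp; omega) fun w hw => ?_
        · simp [hv12, Small]
          and_intros <;> omega
        refine Runs.set_cons ?_ (by simp; omega) fun w' hw' => Runs.nil ?_
        · simp [hv11, Small]
          and_intros <;> omega
        replace hw : w = (2 * cur : ℕ) := by simpa [hv12] using hw
        replace hw' : w' = (kk / 2 : ℕ) := by simpa [hv11] using hw'
        refine ⟨?_, kk / 2, 2 * cur, off', by simp [hw'], by simp [hw], by simp [hv13], ?_, hoff',
          by omega, by omega, by omega, ?_, ?_⟩
        · refine Agree.setVar (Agree.setVar ?_ (by simp) _) (by simp) _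
          exact hA.trans ((hA'.mono (by simp) (by simp)).trans (hA''.mono (by simp) (by simp)))
        · rw [pow_succ] at h4
          omega
        · simp only [← window_add, ← two_mul] at hc'
          rw [hd2]
          exact hc'
        · rw [hd2]
          simp only [State.arr_setVar]
          rw [hA''.2 3 (by simp), hA''.2 4 (by simp)]
          exact hR'
  · simp only [Expr.cost_var]
    nlinarith
  · rintro r τ ⟨hA, kk, cur, off, h1, h2, h3, h4, h5', h6, h7, h8', hT, hR⟩ he
    rw [Expr.eval_var, h1] at he
    obtain rfl : kk = 0 := by omega
    obtain rfl : off = l := by omega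
    exact ⟨hA, ⟨cur, hT.mono (by omega)⟩, hR.mono (by omega)⟩
  · rintro τ ⟨hA, ⟨c, hT⟩, hR⟩
    have ht8 : τ.var 8 = Y := (hA.1 8 (by simp)).trans h8
    refine Runs.cons (runs_fillLoop (Y := Y) (g := τ.arr 3) (g' := τ.arr 4) (by norm_num)
      (by linarith) ht8 (by simp) (by simp) ?_) (by simp; omega) ?_
    · intro υ y hA' hy hyY
      have hc := hR y (by exact_mod_cast hyY)
      have b1 := hc.mantissa_nonneg
      have b2 := hc.mantissa_lt
      have b3 := hc.exponent_nonneg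
      have b4 := hc.exponent_le
      push_cast at b4
      simp [hy, hA'.2 3, hA'.2 4, Small]
      and_intros <;> omega
    · rintro υ ⟨hA', h1, h2⟩
      refine Runs.nil ⟨hA.trans (hA'.mono (by simp) (by simp)), fun y hy => ?_, fun y hy => ?_⟩
      · rw [h1, h2]
        split_ifs with h
        · rw [← window_min hf0 k hy, ← hl]
          exact hR y hy
        -- The copy skips negative indices. There the cells belong to the last doubled window, of
        -- some length `c`, which vanishes like every other window.
        · have hy0 : y < 0 := by omega
          have := hT y hy
          rw [window_of_neg hf0 _ hy0] at this ⊢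
          exact this
      · rw [hA'.2 3 (by simp), hA'.2 4 (by simp)]
        exact (hR y (by omega)).eq_zero (window_of_neg hf0 _ hy)


/-! ### Preprocessing: reflection and the table of powers. -/

/-- Replaces the coefficients in the array `0` by their absolute values, adds those of the negative
ones to the variable `1`, and all of them to the variable `5`. -/
def reflectLoop : Prog :=
  .loop (.bin .lt (.var 4) (.var 0)) (.seq (.block [
    .set 18 (.get 0 (.var 4)),
    .cond (.bin .lt (.var 18) (.lit 0)) (.set 1 (.var 1 - .var 18)) .skip,
    .cond (.bin .lt (.var 18) (.lit 0)) (.set 18 (.lit 0 - .var 18)) .skip,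
    .put 0 (.var 4) (.var 18),
    .set 5 (.var 5 + .var 18)]) (.set 4 (.var 4 + .lit 1)))

/-- All partial sums are dominated by `|b| + ∑ |α i|`, so this one bound covers every intermediate
number derived from the coefficients. -/
theorem runs_reflectLoop {B n : ℕ} {b : ℤ} {α : ℕ → ℤ} {σ : State}
    (hn : (n : ℤ) + 1 < 2 ^ B) (hB : |b| + ∑ i ∈ Finset.range n, |α i| < 2 ^ B)
    (h0 : σ.var 0 = n) (h1 : σ.var 1 = b) (h4 : σ.var 4 = 0) (h5 : σ.var 5 = 0)
    (ha : ∀ i < n, σ.arr 0 i = α i) :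
    Runs B reflectLoop σ ((n + 1) * 40) fun τ => Agree [1, 4, 5, 18] [0] σ τ ∧
      τ.var 1 = b + ∑ i ∈ Finset.range n, (if α i < 0 then -α i else 0) ∧
      τ.var 5 = ∑ i ∈ Finset.range n, |α i| ∧ ∀ i < n, τ.arr 0 i = |α i| := by
  obtain ⟨hb1, hb2⟩ := abs_le.1 (le_refl |b|)
  refine Runs.countup (t := 32) (k := n) (fun j τ => Agree [1, 4, 5, 18] [0] σ τ ∧
      τ.var 1 = b + ∑ i ∈ Finset.range j, (if α i < 0 then -α i else 0) ∧
      τ.var 5 = ∑ i ∈ Finset.range j, |α i| ∧ (∀ i < j, τ.arr 0 i = |α i|) ∧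
      ∀ i < n, j ≤ i → τ.arr 0 i = α i) h4
    ⟨Agree.refl _ _ _, by simpa using h1, by simpa using h5, by simp, fun i hi _ => ha i hi⟩
    ?_ hn ?_ le_rfl ?_
  · rintro j τ ⟨hA, -⟩
    exact (hA.1 0 (by simp)).trans h0
  · rintro j τ hj hj4 ⟨hA, h1, h5, hlt, hge⟩
    have hsum : ∑ i ∈ Finset.range (j + 1), |α i| ≤ ∑ i ∈ Finset.range n, |α i| :=
      Finset.sum_le_sum_of_subset_of_nonneg (Finset.range_subset_range.2 hj)
        fun _ _ _ => abs_nonneg _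
    rw [Finset.sum_range_succ] at hsum
    have hN0 : 0 ≤ ∑ i ∈ Finset.range j, (if α i < 0 then -α i else 0) :=
      Finset.sum_nonneg fun i _ => by split_ifs <;> omega
    have hN1 : ∑ i ∈ Finset.range j, (if α i < 0 then -α i else 0) ≤
        ∑ i ∈ Finset.range j, |α i| := Finset.sum_le_sum fun i _ => by
      split_ifs with h
      · exact neg_le_abs _
      · exact abs_nonneg _
    have hS0 : 0 ≤ ∑ i ∈ Finset.range j, |α i| := Finset.sum_nonneg fun _ _ => abs_nonneg _
    have hsuccN := Finset.sum_range_succ (fun i => if α i < 0 then -α i else 0) j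
    have hsuccS := Finset.sum_range_succ (fun i => |α i|) j
    generalize hNj : ∑ i ∈ Finset.range j, (if α i < 0 then -α i else 0) = N at *
    generalize hSj : ∑ i ∈ Finset.range j, |α i| = S at *
    generalize ∑ i ∈ Finset.range n, |α i| = S' at *
    have haj := hge j hj le_rfl
    have ha1 := neg_le_abs (α j)
    have ha2 := le_abs_self (α j)
    have ha3 := abs_nonneg b
    generalize hx : |α j| = x at *
    refine Runs.set_cons ?_ (by simp) fun v hv => ?_
    · simp [hj4, haj, Small]
      and_intros <;> omega
    replace hv : v = α j := by simpa [hj4, haj] using hv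
    refine Runs.condSet_cons ?_ (fun _ => ?_) (by simp) fun b' hb' => ?_
    · simp [hv, Small]
      and_intros <;> (try split_ifs) <;> omega
    · simp [hv, h1, Small]
      and_intros <;> omega
    replace hb' : b' = if α j < 0 then b + N - α j else b + N := by simpa [hv, h1] using hb'
    refine Runs.condSet_cons ?_ (fun _ => ?_) (by simp) fun v' hv' => ?_
    · simp [hv, Small]
      and_intros <;> (try split_ifs) <;> omega
    · simp [hv, Small]
      and_intros <;> omega
    replace hv' : v' = x := by
      rw [← hx, hv']
      simp [hv]
      split_ifs with h
      · rw [abs_of_neg h]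
      · rw [abs_of_nonneg (by omega)]
    subst hv'
    refine Runs.put_cons ?_ ?_ (by simp) (Runs.set_cons ?_ (by simp) fun s hs => Runs.nil ?_)
    · simp [hj4, Small]; omega
    · simp [Small]; omega
    · simp [h5, Small]
      and_intros <;> omega
    replace hs : s = S + v' := by simpa [h5] using hs
    refine ⟨by simp [hj4], ?_, ?_, ?_, ?_, ?_⟩
    · refine Agree.setVar (Agree.setVar (Agree.setArr ?_ (by simp) _ _) (by simp) _) (by simp) _
      iterate 3 refine Agree.setVar ?_ (by simp) _
      exact hA
    · simp [hsuccN, hb']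
      split_ifs <;> ring
    · simp [hsuccS, hs]
    · intro i hi
      rcases Nat.lt_succ_iff_lt_or_eq.1 hi with h | rfl
      · simp [hj4, hlt i h, h.ne]
      · simp [hj4, hx]
    · intro i hi hji
      have : i ≠ j := by omega
      simp [hj4, this, hge i hi (by omega)]
  · rintro τ ⟨hA, h1, h5, hlt, -⟩
    exact ⟨hA, h1, h5, hlt⟩

theorem update_powTable (q : ℕ) :
    Function.update (powTable q) ((q + 1 : ℕ) : ℤ) (2 ^ (q + 1)) = powTable (q + 1) := by
  funext y
  rcases eq_or_ne y ((q + 1 : ℕ) : ℤ) with rfl | h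
  · have : (0 : ℤ) ≤ (q + 1 : ℕ) := Int.natCast_nonneg _
    rw [Function.update_self, powTable, if_pos ⟨this, le_rfl⟩, Int.toNat_natCast]
  · rw [Function.update_of_ne h, powTable, powTable]
    split_ifs <;> first | rfl | omega

/-- Computes the least power `2 ^ q` of two that is at least the variable `14`, and the table of
the powers up to it. -/
def powerLoop : Prog := .block [
  .set 9 (.lit 1),
  .set 10 (.lit 0),
  .put 5 (.var 10) (.var 9),
  .loop (.bin .lt (.var 9) (.var 14)) (.block [
    .set 9 (.lit 2 * .var 9),
    .set 10 (.var 10 + .lit 1),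
    .put 5 (.var 10) (.var 9)])]

theorem runs_powerLoop {B T : ℕ} {σ : State} (hB : (2 : ℤ) * 2 ^ Nat.clog 2 T < 2 ^ B)
    (h14 : σ.var 14 = T) (h5 : σ.arr 5 = fun _ => 0) :
    Runs B powerLoop σ ((Nat.clog 2 T + 1) * 20 + 10) fun τ =>
      Agree [9, 10] [5] σ τ ∧ τ.var 9 = 2 ^ Nat.clog 2 T ∧ τ.var 10 = Nat.clog 2 T ∧
      τ.arr 5 = powTable (Nat.clog 2 T) := by
  obtain ⟨q, hq⟩ : ∃ q, q = Nat.clog 2 T := ⟨_, rfl⟩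
  have hTq : (T : ℤ) ≤ 2 ^ q := by
    rw [hq]; exact_mod_cast Nat.le_pow_clog one_lt_two T
  have hqlt : (q : ℤ) < 2 ^ q := by exact_mod_cast Nat.lt_two_pow_self
  have hqpos : (1 : ℤ) ≤ 2 ^ q := by linarith [Int.natCast_nonneg q]
  rw [← hq] at hB ⊢
  refine Runs.set_cons ?_ (by simp) fun v hv => Runs.set_cons ?_ (by simp) fun w hw =>
    Runs.put_cons ?_ ?_ (by simp) ?_
  · simp [Small]; and_intros <;> linarith
  · simp [Small]
  · simp [hw, Small]
  · simp [hv, Small]; and_intros <;> linarith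
  simp only [Expr.eval_lit] at hv hw
  subst hv hw
  refine Runs.cons (Runs.loop (t := 16) (fun r τ => Agree [9, 10] [5] σ τ ∧ r ≤ q ∧
      τ.var 9 = 2 ^ (q - r) ∧ τ.var 10 = (q - r : ℕ) ∧ τ.arr 5 = powTable (q - r)) q
      ⟨?_, le_rfl, by simp, by simp, ?_⟩ ?_ ?_ le_rfl (Q := fun τ =>
      Agree [9, 10] [5] σ τ ∧ τ.var 9 = 2 ^ q ∧ τ.var 10 = q ∧ τ.arr 5 = powTable q) ?_)
      (by simp) fun τ h => .nil h
  · exact (((Agree.refl _ _ _).setVar (by simp) _).setVar (by simp) _).setArr (by simp) _ _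
  · funext y
    simp [h5, powTable, Function.update_apply]
    split_ifs <;> first | rfl | omega | skip
    have : y = 0 := by omega
    simp [this]
  · rintro r τ ⟨hA, hr, h9, h10, ha⟩
    have hp : (2 : ℤ) ^ (q - r) ≤ 2 ^ q := pow_le_pow_right₀ (by norm_num) (by omega)
    have hp0 : (0 : ℤ) < 2 ^ (q - r) := by positivity
    have ht : τ.var 14 = T := (hA.1 14 (by simp)).trans h14
    simp [h9, ht, Small]
    and_intros <;> (try split_ifs) <;> linarith [Int.natCast_nonneg T]
  · rintro r τ ⟨hA, hr, h9, h10, ha⟩ hne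
    have ht : τ.var 14 = T := (hA.1 14 (by simp)).trans h14
    have hlt : 2 ^ (q - r) < T := by
      simp [h9, ht] at hne
      exact_mod_cast hne
    have hr0 : r ≠ 0 := by
      rintro rfl
      have : (T : ℤ) ≤ 2 ^ q := hTq
      norm_cast at this
      simp at hlt
      omega
    obtain ⟨r, rfl⟩ := Nat.exists_eq_succ_of_ne_zero hr0
    have hqr : q - r = q - (r + 1) + 1 := by omega
    have hp : (2 : ℤ) ^ (q - r) ≤ 2 ^ q := pow_le_pow_right₀ (by norm_num) (by omega)
    have hp1 : (2 : ℤ) ^ (q - r) = 2 * 2 ^ (q - (r + 1)) := by rw [hqr, pow_succ']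
    have hp0 : (0 : ℤ) < 2 ^ (q - (r + 1)) := by positivity
    refine ⟨r, rfl, Runs.set_cons ?_ (by simp) fun v hv => Runs.set_cons ?_ (by simp) fun w hw =>
      Runs.put_cons ?_ ?_ (by simp) (Runs.nil ?_)⟩
    · simp [h9, Small]; and_intros <;> linarith
    · simp [h10, Small]; and_intros <;> omega
    · simp [hw, h10, Small]; and_intros <;> omega
    · simp [hv, h9, Small]; and_intros <;> linarith
    replace hv : v = 2 ^ (q - r) := by rw [hp1]; simpa [h9] using hv
    replace hw : w = (q - r : ℕ) := by rw [hqr]; simpa [h10] using hw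
    subst hv hw
    refine ⟨((hA.setVar (by simp) _).setVar (by simp) _).setArr (by simp) _ _, by omega,
      by simp, by simp, ?_⟩
    rw [State.arr_setArr, if_pos rfl]
    simp only [Expr.eval_var, State.var_setVar, if_true, State.arr_setVar, ha]
    rw [hqr, ← update_powTable]
    simp
  · rintro r τ ⟨hA, hr, h9, h10, ha⟩ he
    have ht : τ.var 14 = T := (hA.1 14 (by simp)).trans h14
    have hle : T ≤ 2 ^ (q - r) := by
      simp [h9, ht] at he
      exact_mod_cast he
    -- The exit power is at least `T` and `q` is the least such exponent, so no rounds can be left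
    -- over.
    have : q ≤ q - r := by
      rw [hq] at hle ⊢
      exact Nat.clog_le_of_le_pow hle
    have hr0 : q - r = q := by omega
    rw [hr0] at h9 h10 ha
    exact ⟨hA, h9, h10, ha⟩


/-! ### The dynamic program. -/

/-- The parameters of the main part of the algorithm, and what has to hold for them. -/
structure Setup (n M Y q B : ℕ) (b : ℤ) (α : ℕ → ℤ) (k : ℕ → ℕ) : Prop where
  one_le_q : 1 ≤ q
  bits : 16 * (2 ^ q * 2 ^ q) < (2 : ℤ) ^ B
  target : (Y : ℤ) + 2 ≤ 2 ^ q
  depth : 2 * ((n + 1) * (q + 2)) ≤ (2 : ℤ) ^ q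
  bound_pos : 0 < b
  bound_lt : b < 2 ^ B
  scale : (M : ℤ) ≤ 2 ^ q
  coeff_nonneg : ∀ i < n, 0 ≤ α i
  coeff_lt : ∀ i < n, α i < 2 ^ q
  scaled_lt : ∀ i < n, α i * M < 2 ^ q
  one_le_k : ∀ i, 1 ≤ k i
  k_eq : ∀ i < n, (k i : ℤ) = α i * M / b + 1

/-- The memory holds the parameters. -/
structure Ready (n M Y q : ℕ) (b : ℤ) (α : ℕ → ℤ) (σ : State) : Prop where
  var0 : σ.var 0 = n
  var1 : σ.var 1 = b
  var7 : σ.var 7 = M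
  var8 : σ.var 8 = Y
  var9 : σ.var 9 = 2 ^ q
  var10 : σ.var 10 = q
  arr0 : ∀ i < n, σ.arr 0 i = α i
  arr5 : σ.arr 5 = powTable q

/-- The listed variables and arrays are the scratch memory of the counting and division loops; the
parameters live elsewhere. -/
theorem Ready.of_agree {n M Y q : ℕ} {b : ℤ} {α : ℕ → ℤ} {σ τ : State}
    (h : Ready n M Y q b α σ) (hA : Agree [4, 11, 12, 13, 15, 16, 17, 19] [1, 2, 3, 4] σ τ) :
    Ready n M Y q b α τ where
  var0 := (hA.1 0 (by simp)).trans h.var0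
  var1 := (hA.1 1 (by simp)).trans h.var1
  var7 := (hA.1 7 (by simp)).trans h.var7
  var8 := (hA.1 8 (by simp)).trans h.var8
  var9 := (hA.1 9 (by simp)).trans h.var9
  var10 := (hA.1 10 (by simp)).trans h.var10
  arr0 := by rw [hA.2 0 (by simp)]; exact h.arr0
  arr5 := (hA.2 5 (by simp)).trans h.arr5

theorem Ready.setVar {n M Y q : ℕ} {b : ℤ} {α : ℕ → ℤ} {σ : State}
    (h : Ready n M Y q b α σ) {x : ℕ} (hx : x ∈ [4, 11, 12, 13, 15, 16, 17, 19]) (v : ℤ) :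
    Ready n M Y q b α (σ.setVar x v) :=
  h.of_agree ((Agree.refl _ _ _).setVar hx v)

namespace Setup

variable {n M Y q B : ℕ} {b : ℤ} {α : ℕ → ℤ} {k : ℕ → ℕ} {σ : State}

theorem two_le (h : Setup n M Y q B b α k) : (2 : ℤ) ≤ 2 ^ q := by
  calc (2 : ℤ) = 2 ^ 1 := by norm_num
    _ ≤ 2 ^ q := pow_le_pow_right₀ (by norm_num) h.one_le_q

theorem bits' (h : Setup n M Y q B b α k) : (16 : ℤ) * 2 ^ q < 2 ^ B := by
  have h1 := h.two_le
  have h2 := h.bits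
  nlinarith

theorem k_le (h : Setup n M Y q B b α k) {i : ℕ} (hi : i < n) : (k i : ℤ) ≤ 2 ^ q := by
  have h1 : α i * M / b ≤ α i * M := Int.ediv_le_self _
    (mul_nonneg (h.coeff_nonneg i hi) (Int.natCast_nonneg _))
  have h2 := h.scaled_lt i hi
  rw [h.k_eq i hi]
  omega

/-- The expression for the number of values of a coordinate. -/
theorem fits_eval_k (h : Setup n M Y q B b α k) (hσ : Ready n M Y q b α σ) {i : ℕ} (hi : i < n)
    (h4 : σ.var 4 = i) :
    (Expr.get 0 (.var 4) * .var 7 / .var 1 + .lit 1).Fits B σ ∧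
      (Expr.get 0 (.var 4) * .var 7 / .var 1 + .lit 1).eval σ = k i := by
  have h1 := h.coeff_nonneg i hi
  have h2 := h.coeff_lt i hi
  have h3 := h.scaled_lt i hi
  have h5 := h.bits'
  have h6 := h.two_le
  have h7 := h.bound_pos
  have h8 := h.bound_lt
  have h9 := h.scale
  have h10 := h.k_le hi
  have h11 : (0 : ℤ) ≤ M := Int.natCast_nonneg _
  have h12 := h.k_eq i hi
  have h13 : 0 ≤ α i * M := mul_nonneg h1 h11
  have h14 : (i : ℤ) ≤ 2 ^ q := by
    have : (i : ℤ) < n := by exact_mod_cast hi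
    have := h.depth
    nlinarith [Int.natCast_nonneg q, Int.natCast_nonneg n]
  have h15 : (0 : ℤ) ≤ i := Int.natCast_nonneg _
  have h16 : (1 : ℤ) ≤ k i := by exact_mod_cast h.one_le_k i
  constructor
  · simp [h4, hσ.arr0 i hi, hσ.var7, hσ.var1, Small]
    and_intros <;> omega
  · simp [h4, hσ.arr0 i hi, hσ.var7, hσ.var1, h12]

end Setup

/-- The dynamic program over the coordinates. -/
def countLoop : Prog := .block [
  fillLoop 1 2 (.var 9) (.lit 0),
  .set 4 (.lit 0),
  .loop (.bin .lt (.var 4) (.var 0)) (.seq (.block [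
    .set 11 (.get 0 (.var 4) * .var 7 / .var 1 + .lit 1),
    windowSum]) (.set 4 (.var 4 + .lit 1)))]

/-- The counts are stored with an extra factor `2 ^ q`: the initial value `1` then has mantissa `2 ^
q` and exponent `0`, and no exponent ever becomes negative here. Each coordinate adds depth `2 * (q
+ 1)`. -/
theorem runs_countLoop {n M Y q B : ℕ} {b : ℤ} {α : ℕ → ℤ} {k : ℕ → ℕ} {σ : State}
    (h : Setup n M Y q B b α k) (hσ : Ready n M Y q b α σ)
    (h1 : σ.arr 1 = fun _ => 0) (h2 : σ.arr 2 = fun _ => 0)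
    (h3 : σ.arr 3 = fun _ => 0) (h4 : σ.arr 4 = fun _ => 0) :
    Runs B countLoop σ ((n + 2) * ((q + 3) * ((Y + 2) * 300) + 30)) fun τ =>
      Ready n M Y q b α τ ∧
      Cells q (2 * (q + 1) * n) Y (fun y => 2 ^ q * cnt k n y) (τ.arr 1) (τ.arr 2) := by
  have a1 := h.two_le
  have a2 := h.bits'
  have a3 := h.target
  have a4 : (0 : ℤ) ≤ Y := Int.natCast_nonneg _
  have a5 := h.depth
  have a6 : (0 : ℤ) ≤ q := Int.natCast_nonneg _
  have a7 : (0 : ℤ) ≤ n := Int.natCast_nonneg _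
  have a8 : (n : ℤ) + 1 ≤ 2 ^ q := by nlinarith
  have hT : (Y + 2) * 14 + 10 + (2 + (n + 1) * ((q + 3) * ((Y + 2) * 300) + 20 + 8)) ≤
      (n + 2) * ((q + 3) * ((Y + 2) * 300) + 30) := by
    have : (Y + 2) * 14 ≤ (q + 3) * ((Y + 2) * 300) := by nlinarith
    nlinarith
  refine Runs.cons (runs_fillLoop (Y := Y) (g := fun _ => 2 ^ q) (g' := fun _ => 0) (by norm_num)
    (by linarith) hσ.var8 (by simp) (by simp) (fun τ y hA _ _ => ?_))
    (le_trans (Nat.le_add_right _ _) hT) ?_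
  · have : τ.var 9 = 2 ^ q := (hA.1 9 (by simp)).trans hσ.var9
    simp [this, Small]
    and_intros <;> linarith
  rintro τ₀ ⟨hA, f1, f2⟩
  have hτ₀ : Ready n M Y q b α τ₀ := hσ.of_agree (hA.mono (by simp) (by simp))
  refine Runs.set_cons (by simp [Small]) (by simp; omega) fun v hv => ?_
  replace hv : v = 0 := by simpa using hv
  subst hv
  refine Runs.cons (T := (n + 1) * ((q + 3) * ((Y + 2) * 300) + 20 + 8))
    (Runs.countup (t := (q + 3) * ((Y + 2) * 300) + 20) (k := n)
      (fun i τ => Ready n M Y q b α τ ∧ (∀ y < 0, τ.arr 3 y = 0 ∧ τ.arr 4 y = 0) ∧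
        Cells q (2 * (q + 1) * i) Y (fun y => 2 ^ q * cnt k i y) (τ.arr 1) (τ.arr 2))
      (by simp) ⟨hτ₀.setVar (by simp) _, ?_, ?_⟩ ?_ (by linarith) ?_ le_rfl ?_)
    (by simp; omega) (fun τ h => .nil h)
  · intro y _
    simp only [State.arr_setVar]
    rw [hA.2 3 (by simp), hA.2 4 (by simp), h3, h4]
    exact ⟨rfl, rfl⟩
  · intro y hy
    simp only [State.arr_setVar, f1, f2, h1, h2, cnt, hy, and_true]
    split_ifs with h0
    · refine Or.inr ⟨⟨?_, ?_, ?_, ?_⟩, le_rfl, by simp⟩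
      · linarith
      · linarith
      · simp
      · simp
    · simp only [Nat.cast_zero, mul_zero]
      exact cell_zero _ _
  · rintro i τ ⟨hτ, -⟩
    exact hτ.var0
  · rintro i τ hi hi4 ⟨hτ, hz, hc⟩
    obtain ⟨g1, g2⟩ := h.fits_eval_k hτ hi hi4
    have hk := h.k_le hi
    have hin : (i : ℤ) + 1 ≤ n := by exact_mod_cast hi
    refine Runs.set_cons g1 (by simp) fun v hv => ?_
    rw [g2] at hv
    subst hv
    have hτ' := hτ.setVar (x := 11) (by simp) (k i : ℤ)
    refine Runs.cons (runs_windowSum (f := fun y => 2 ^ q * cnt k i y) h.one_le_q a2 a3 ?_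
      (h.one_le_k i) (by linarith) hτ'.var8 hτ'.var9 (by simp) hτ'.arr5 hc ?_ ?_ hz)
      (by simp) ?_
    · push_cast
      nlinarith
    · intro y hy
      simp [cnt_of_neg k i y hy]
    · intro y hy
      have := cnt_pos k h.one_le_k i y hy
      positivity
    · rintro υ ⟨hA', hc', hz'⟩
      refine Runs.nil ⟨?_, ?_, hz', ?_⟩
      · rw [hA'.1 4 (by simp)]; simpa using hi4
      · exact (hτ'.of_agree (hA'.mono (by simp) (by simp))).setVar (by simp) _
      · intro y hy
        have := hc' y hy
        rw [window_cnt] at this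
        exact this.mono (by nlinarith)
  · rintro τ ⟨hτ, -, hc⟩
    exact ⟨hτ, hc⟩

/-! ### Division by the number of grid boxes. -/

/-- Divides the floating-point number in the variables `17` and `16` by the number of values of
the current coordinate. -/
def divideStep : Prog := .block [
  .set 11 (.get 0 (.var 4) * .var 7 / .var 1 + .lit 1),
  .set 19 (.lit 0),
  .loop (.bin .lt (.get 5 (.var 19)) (.var 11)) (.block [.set 19 (.var 19 + .lit 1)]),
  .set 17 (.var 17 * .get 5 (.var 19) / .var 11 + .lit 1),
  .set 16 (.var 16 - .var 19),
  .cond (.bin .le (.lit 2 * .var 9) (.var 17)) (.set 16 (.var 16 + .lit 2)) .skip,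
  .cond (.bin .le (.lit 2 * .var 9) (.var 17)) (.set 17 (.var 17 / .lit 4 + .lit 1)) .skip]

theorem runs_divideStep {n M Y q B i d : ℕ} {b : ℤ} {α : ℕ → ℤ} {k : ℕ → ℕ} {τ : State} {w : ℝ}
    {m e : ℤ} (h : Setup n M Y q B b α k) (hτ : Ready n M Y q b α τ) (hi : i < n)
    (hi4 : τ.var 4 = i) (hm : τ.var 17 = m) (he : τ.var 16 = e) (hap : Approx q d w m e)
    (he1 : -2 ^ q ≤ e) (he2 : e ≤ 2 ^ q) :
    Runs B divideStep τ ((q + 2) * 20 + 82) fun υ => Agree [11, 16, 17, 19] [] τ υ ∧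
      Approx q (d + 2) (w / k i) (υ.var 17) (υ.var 16) ∧
      e - q ≤ υ.var 16 ∧ υ.var 16 ≤ e + 2 := by
  have a1 := h.two_le
  have a2 := h.bits'
  have a2' := h.bits
  have a6 : (0 : ℤ) ≤ q := Int.natCast_nonneg _
  have a9 : (q : ℤ) + 2 ≤ 2 ^ q := by
    have := h.depth
    nlinarith [Int.natCast_nonneg n]
  obtain ⟨g1, g2⟩ := h.fits_eval_k hτ hi hi4
  have hk := h.k_le hi
  have hk1 : (1 : ℤ) ≤ k i := by exact_mod_cast h.one_le_k i
  have m1 := hap.nonneg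
  have m2 := hap.upper
  refine Runs.set_cons g1 (by simp) fun v hv => ?_
  rw [g2] at hv
  subst hv
  refine Runs.set_cons (by simp [Small]) (by simp) fun v hv => ?_
  replace hv : v = 0 := by simpa using hv
  subst hv
  -- The scan through the table stops exactly at this `c`, the exponent with `k i ≤ 2 ^ c < 2 * k i`
  -- that `Approx.div` needs.
  obtain ⟨c, hcdef⟩ : ∃ c, c = Nat.clog 2 (k i) := ⟨_, rfl⟩
  have hcq : c ≤ q := by
    rw [hcdef]
    exact Nat.clog_le_of_le_pow (by exact_mod_cast hk)
  have hcq' : (c : ℤ) ≤ q := by exact_mod_cast hcq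
  have hkc : (k i : ℤ) ≤ 2 ^ c := by
    rw [hcdef]; exact_mod_cast Nat.le_pow_clog one_lt_two (k i)
  have hck : (2 : ℤ) ^ c < 2 * k i := by
    rcases Nat.eq_zero_or_pos c with h0 | h0
    · rw [h0]; linarith
    · have : 2 ^ (c - 1) < k i := by
        rw [← not_le]
        intro hle
        have := Nat.clog_le_of_le_pow hle
        omega
      have h2 : (2 : ℤ) ^ c = 2 * 2 ^ (c - 1) := by
        rw [← pow_succ']; congr 1; omega
      rw [h2]
      have : (2 : ℤ) ^ (c - 1) < k i := by exact_mod_cast this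
      linarith
  have hcQ : (2 : ℤ) ^ c ≤ 2 ^ q := pow_le_pow_right₀ (by norm_num) hcq
  have hc0 : (0 : ℤ) < 2 ^ c := by positivity
  refine Runs.cons (T := (q + 2) * 20) (R := fun υ =>
    Agree [19] [] ((τ.setVar 11 (k i)).setVar 19 0) υ ∧ υ.var 19 = c)
    (Runs.loop (t := 10) (fun r υ => Agree [19] [] ((τ.setVar 11 (k i)).setVar 19 0) υ ∧
      r ≤ c ∧ υ.var 19 = (c - r : ℕ)) c ⟨Agree.refl _ _ _, le_rfl, by simp⟩ ?_ ?_ ?_ ?_)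
      (by simp) ?_
  · rintro r υ ⟨hA, hr, h19⟩
    have u5 : υ.arr 5 = powTable q := (hA.2 5 (by simp)).trans hτ.arr5
    have u11 : υ.var 11 = k i := (hA.1 11 (by simp)).trans (by simp)
    have p1 := powTable_nonneg q (c - r : ℕ)
    have p2 := powTable_le q (c - r : ℕ)
    simp only [Expr.fits_lt, Expr.fits_get, Expr.fits_var, Expr.eval_var, Expr.eval_get, u5, u11,
      h19, Small]
    and_intros <;> (try split_ifs) <;> omega
  · rintro r υ ⟨hA, hr, h19⟩ hne
    have u5 : υ.arr 5 = powTable q := (hA.2 5 (by simp)).trans hτ.arr5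
    have u11 : υ.var 11 = k i := (hA.1 11 (by simp)).trans (by simp)
    have hr0 : r ≠ 0 := by
      rintro rfl
      have : powTable q c = 2 ^ c := by simp [powTable, hcq]
      simp [u5, u11, h19, this] at hne
      linarith
    obtain ⟨r, rfl⟩ := Nat.exists_eq_succ_of_ne_zero hr0
    refine ⟨r, rfl, Runs.set_cons ?_ (by simp) fun v hv => Runs.nil
      ⟨hA.setVar (by simp) _, by omega, ?_⟩⟩
    · simp only [Expr.fits_add, Expr.fits_var, Expr.fits_lit, Expr.eval_var, Expr.eval_lit, h19,
        Small]
      and_intros <;> omega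
    · simp only [Expr.eval_add, Expr.eval_var, Expr.eval_lit, h19] at hv
      simp only [State.var_setVar, if_true, hv]
      omega
  · simp only [Expr.cost_bin, Expr.cost_get, Expr.cost_var]
    nlinarith
  · rintro r υ ⟨hA, hr, h19⟩ hz
    have u5 : υ.arr 5 = powTable q := (hA.2 5 (by simp)).trans hτ.arr5
    have u11 : υ.var 11 = k i := (hA.1 11 (by simp)).trans (by simp)
    have hpw : powTable q (c - r : ℕ) = 2 ^ (c - r) := by
      rw [powTable, if_pos (by omega), Int.toNat_natCast]
    have hle : (k i : ℤ) ≤ 2 ^ (c - r) := by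
      simp only [Expr.eval_lt, Expr.eval_get, Expr.eval_var, u5, u11, h19, hpw] at hz
      by_contra! hlt
      simp [hlt] at hz
    have hle' : k i ≤ 2 ^ (c - r) := by exact_mod_cast hle
    have := Nat.clog_le_of_le_pow hle'
    refine ⟨hA, ?_⟩
    rw [h19]
    omega
  · rintro υ ⟨hA, h19⟩
    have hυ : Ready n M Y q b α υ :=
      ((hτ.setVar (x := 11) (by simp) (k i : ℤ)).setVar (x := 19) (by simp) 0).of_agree
        (hA.mono (by simp) (by simp))
    have u11 : υ.var 11 = k i := (hA.1 11 (by simp)).trans (by simp)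
    have u17 : υ.var 17 = m := (hA.1 17 (by simp)).trans (by simpa using hm)
    have u16 : υ.var 16 = e := (hA.1 16 (by simp)).trans (by simpa using he)
    have u4 : υ.var 4 = i := (hA.1 4 (by simp)).trans (by simpa using hi4)
    have u5c : powTable q c = 2 ^ c := by simp [powTable, hcq]
    obtain ⟨g1, g2, g3, g4⟩ := hap.div (by linarith : (0 : ℤ) < k i) hkc hck
    -- A full mantissa times a power of two: this product is the reason why the bit bound admits
    -- twice the precision.
    have p1 : m * 2 ^ c ≤ 2 * (2 ^ q * 2 ^ q) := by nlinarith
    have p2 : 0 < m * 2 ^ c := by positivity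
    have p3 : 0 ≤ m * 2 ^ c / k i := Int.ediv_nonneg p2.le (by linarith)
    have hn := approx_normalize h.one_le_q g1 g2 g3 g4
    obtain ⟨z, hz⟩ : ∃ z, m * 2 ^ c = z := ⟨_, rfl⟩
    rw [hz] at g1 g2 g3 g4 p1 p2 p3 hn
    obtain ⟨x, hx⟩ : ∃ x, z / (k i : ℤ) = x := ⟨_, rfl⟩
    rw [hx] at g1 g2 g3 g4 p3 hn
    refine Runs.set_cons ?_ (by simp) fun m' hm' => ?_
    · simp only [Expr.fits_add, Expr.fits_div, Expr.fits_mul, Expr.fits_var, Expr.fits_get,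
        Expr.fits_lit, Expr.eval_div, Expr.eval_mul, Expr.eval_var,
        Expr.eval_get, Expr.eval_lit, u17, h19, hυ.arr5, u5c, u11, hz, hx, Small]
      and_intros <;> linarith
    replace hm' : m' = x + 1 := by simpa [u17, h19, hυ.arr5, u5c, u11, hz, hx] using hm'
    refine Runs.set_cons ?_ (by simp) fun e' he' => ?_
    · simp [u16, h19, Small]
      and_intros <;> linarith
    replace he' : e' = e - c := by simpa [u16, h19] using he'
    refine Runs.condSet_cons ?_ (fun _ => ?_) (by simp) fun f hf => ?_
    · simp [hυ.var9, hm', Small]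
      and_intros <;> (try split_ifs) <;> linarith
    · simp [he', Small]
      and_intros <;> linarith
    replace hf : f = if 2 * 2 ^ q ≤ x + 1 then e - c + 2 else e - c := by
      simpa [hυ.var9, he', hm'] using hf
    refine Runs.condSet_cons ?_ (fun _ => ?_) (by simp) fun g hg => Runs.nil ?_
    · simp [hυ.var9, hm', Small]
      and_intros <;> (try split_ifs) <;> linarith
    · simp [hm', Small]
      and_intros <;> omega
    replace hg : g = if 2 * 2 ^ q ≤ x + 1 then (x + 1) / 4 + 1 else x + 1 := by
      simpa [hυ.var9, hm'] using hg
    rw [← hf, ← hg] at hn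
    refine ⟨?_, ?_, ?_⟩
    · iterate 4 refine Agree.setVar ?_ (by simp) _
      refine Agree.trans ?_ (hA.mono (by simp) (by simp))
      exact ((Agree.refl _ _ _).setVar (by simp) _).setVar (by simp) _
    · simpa using hn
    · simp only [State.var_setVar]
      norm_num
      rw [hf]
      split_ifs <;> constructor <;> linarith [Int.natCast_nonneg c]

/-- Divides the floating-point number in the variables `17` and `16` by the number of values of
each coordinate. -/
def divideLoop : Prog := .block [
  .set 17 (.get 1 (.var 8)),
  .set 16 (.get 2 (.var 8) - .var 10),
  .set 4 (.lit 0),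
  .loop (.bin .lt (.var 4) (.var 0)) (.seq divideStep
    (.set 4 (.var 4 + .lit 1)))]

theorem runs_divideLoop {n M Y q B : ℕ} {b : ℤ} {α : ℕ → ℤ} {k : ℕ → ℕ} {σ : State}
    (h : Setup n M Y q B b α k) (hσ : Ready n M Y q b α σ)
    (hc : Cells q (2 * (q + 1) * n) Y (fun y => 2 ^ q * cnt k n y) (σ.arr 1) (σ.arr 2)) :
    Runs B divideLoop σ ((n + 2) * ((q + 2) * 20 + 100)) fun τ =>
      Approx q (2 * (n * (q + 2))) (cnt k n Y / ∏ i ∈ Finset.range n, (k i : ℝ))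
        (τ.var 17) (τ.var 16) ∧ Small B (τ.var 17) ∧ Small B (τ.var 16) := by
  have a1 := h.two_le
  have a2 := h.bits'
  have a2' := h.bits
  have a3 := h.target
  have a4 : (0 : ℤ) ≤ Y := Int.natCast_nonneg _
  have a5 := h.depth
  have a6 : (0 : ℤ) ≤ q := Int.natCast_nonneg _
  have a7 : (0 : ℤ) ≤ n := Int.natCast_nonneg _
  have a8 : (n : ℤ) + 1 ≤ 2 ^ q := by nlinarith
  have a9 : (q : ℤ) + 2 ≤ 2 ^ q := by nlinarith
  have a10 : 2 * (q * n) + 4 * n + 2 * q + 4 ≤ (2 : ℤ) ^ q := by nlinarith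
  have a11 : 0 ≤ (q : ℤ) * n := by positivity
  have c0 := hc Y le_rfl
  have b1 := c0.mantissa_nonneg
  have b2 := c0.mantissa_lt
  have b3 := c0.exponent_nonneg
  have b4 := c0.exponent_le
  push_cast at b4
  have hcp : (0 : ℝ) < 2 ^ q * cnt k n Y := by
    have := cnt_pos k h.one_le_k n Y a4
    positivity
  have hap := c0.approx hcp
  have hT : (n + 1) * ((q + 2) * 20 + 82 + 8) + 20 ≤ (n + 2) * ((q + 2) * 20 + 100) := by nlinarith
  refine Runs.set_cons ?_ (by simp; omega) fun m hm => Runs.set_cons ?_ (by simp; omega) fun e he =>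
    Runs.set_cons (by simp [Small]) (by simp; omega) fun v hv => ?_
  · simp [hσ.var8, Small]
    and_intros <;> omega
  · simp [hσ.var8, hσ.var10, Small]
    and_intros <;> linarith
  replace hm : m = σ.arr 1 Y := by simpa [hσ.var8] using hm
  replace he : e = σ.arr 2 Y - q := by simpa [hσ.var8, hσ.var10] using he
  replace hv : v = 0 := by simpa using hv
  subst hv
  -- Subtracting `q` from the exponent cancels the factor `2 ^ q` of the table.
  have hap0 : Approx q (2 * (q + 1) * n) (cnt k n Y) m e := by
    have hp : (2 : ℝ) ^ (σ.arr 2 Y) = 2 ^ q * 2 ^ e := by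
      rw [← zpow_natCast, ← zpow_add₀ (by norm_num)]; congr 1; omega
    have hq0 : (0 : ℝ) < 2 ^ q := by positivity
    obtain ⟨l1, l2, l3, l4⟩ := hap
    rw [hp] at l3 l4
    rw [hm]
    refine ⟨l1, l2, ?_, ?_⟩
    · refine le_of_mul_le_mul_left ?_ hq0
      linarith
    · refine le_of_mul_le_mul_left ?_ hq0
      linarith
  -- The exponent falls by at most `q` and rises by at most `2` per division, so it stays within `±
  -- 2 ^ q` and fits.
  refine Runs.cons (T := (n + 1) * ((q + 2) * 20 + 82 + 8))
    (Runs.countup (t := (q + 2) * 20 + 82) (k := n)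
      (fun i τ => Ready n M Y q b α τ ∧
        Approx q (2 * (q + 1) * n + 2 * i) (cnt k n Y / ∏ j ∈ Finset.range i, (k j : ℝ))
          (τ.var 17) (τ.var 16) ∧
        -((i + 1) * q) ≤ τ.var 16 ∧ τ.var 16 ≤ 2 * (q + 1) * n + 2 * i)
      (by simp) ⟨?_, ?_, ?_⟩ ?_ (by linarith) ?_ le_rfl ?_)
    (by simp; omega) (fun τ h => .nil h)
  · exact ((hσ.setVar (by simp) _).setVar (by simp) _).setVar (by simp) _
  · simpa using hap0
  · simp only [State.var_setVar]
    norm_num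
    rw [he]
    constructor <;> linarith
  · rintro i τ ⟨hτ, -⟩
    exact hτ.var0
  · rintro i τ hi hi4 ⟨hτ, hap, he1, he2⟩
    have hin : (i : ℤ) + 1 ≤ n := by exact_mod_cast hi
    have he3 : -((n : ℤ) * q) ≤ -((i + 1) * q) := by nlinarith
    refine (runs_divideStep h hτ hi hi4 rfl rfl hap (by linarith) (by linarith)).mono le_rfl ?_
    rintro υ ⟨hA, hap', he1', he2'⟩
    refine ⟨(hA.1 4 (by simp)).trans hi4,
      (hτ.of_agree (hA.mono (by simp) (by simp))).setVar (by simp) _, ?_, ?_⟩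
    · rw [Finset.prod_range_succ, ← div_div]
      simpa [mul_add, add_assoc] using hap'
    · simp only [State.var_setVar]
      norm_num
      constructor <;> linarith
  · rintro τ ⟨hτ, hap, he1, he2⟩
    refine ⟨?_, ?_, ?_⟩
    · convert hap using 1; ring
    · have := hap.nonneg
      have := hap.upper
      constructor <;> linarith
    · constructor <;> linarith


/-! ### Choice of precision and total error. -/

/-- The precision: a number `q` of bits that suffices for `n` coordinates with coefficient sum `s`
and the relative error `1 / r`. -/
def precision (n r s : ℕ) : ℕ := Nat.clog 2 (300 * (8 * n * n * r) * r * (s + 1))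

theorem le_two_pow_precision (n r s : ℕ) :
    300 * (8 * n * n * r) * r * (s + 1) ≤ 2 ^ precision n r s := Nat.le_pow_clog one_lt_two _

theorem add_two_sq_le (q : ℕ) : (q + 2) ^ 2 ≤ 9 * 2 ^ q := by
  -- The induction starts at exponent one: from zero to one the square `(q + 2) ^ 2` more than
  -- doubles.
  have h : ∀ j, (j + 1 + 2) ^ 2 ≤ 9 * 2 ^ (j + 1) := by
    intro j
    induction j with
    | zero => norm_num
    | succ j ih =>
      rw [pow_succ 2 (j + 1)]
      have : (j + 1 + 1 + 2) ^ 2 ≤ 2 * (j + 1 + 2) ^ 2 := by nlinarith [Nat.zero_le (j * j)]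
      linarith
  rcases q with _ | q
  · norm_num
  · exact h q

/-- Here the precision bounds a multiple of itself. After squaring, `(q + 2) ^ 2 ≤ 9 * 2 ^ q`
reduces the claim to `9 * (16 * n * r) ^ 2 ≤ 2 ^ q`, and the constant `300` gives `300 * 8 = 2400 ≥
2304 = 9 * 16 ^ 2`. -/
theorem depth_le_two_pow_precision (n r s : ℕ) :
    16 * n * r * (precision n r s + 2) ≤ 2 ^ precision n r s := by
  have h1 := le_two_pow_precision n r s
  have h2 := add_two_sq_le (precision n r s)
  generalize precision n r s = q at *
  have h3 : 9 * (16 * n * r) ^ 2 ≤ 2 ^ q := by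
    refine le_trans ?_ h1
    calc 9 * (16 * n * r) ^ 2 ≤ 300 * (8 * n * n * r) * r * 1 := by nlinarith [sq_nonneg (n * r)]
      _ ≤ _ := Nat.mul_le_mul_left _ (by omega)
  refine (Nat.pow_le_pow_iff_left two_ne_zero).1 ?_
  calc (16 * n * r * (q + 2)) ^ 2 = (16 * n * r) ^ 2 * (q + 2) ^ 2 := by ring
    _ ≤ (16 * n * r) ^ 2 * (9 * 2 ^ q) := Nat.mul_le_mul_left _ h2
    _ = 9 * (16 * n * r) ^ 2 * 2 ^ q := by ring
    _ ≤ 2 ^ q * 2 ^ q := Nat.mul_le_mul_right _ h3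
    _ = (2 ^ q) ^ 2 := by ring

/-- From `exp (-x) ≥ 1 - x` and `(1 + 2 * x) * (1 - x) ≥ 1` on this range. -/
theorem exp_le_of_le_half {x : ℝ} (h0 : 0 ≤ x) (h : x ≤ 1 / 2) : Real.exp x ≤ 1 + 2 * x := by
  have h1 := Real.add_one_le_exp (-x)
  have h2 : Real.exp x * Real.exp (-x) = 1 := by rw [← Real.exp_add]; simp
  have h3 := Real.exp_pos x
  by_contra! h4
  nlinarith

/-- The approximation algorithm for nonnegative coefficients and a positive right-hand side. -/
def estimate : Prog := .block [
  .set 6 (.var 3 / .var 2 + .lit 1),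
  .set 7 (.lit 8 * .var 0 * .var 0 * .var 6),
  .set 8 (.var 7 + .var 0),
  .set 14 (.lit 300 * .var 7 * .var 6 * (.var 5 + .lit 1)),
  powerLoop,
  countLoop,
  divideLoop,
  .set 0 (.var 17),
  .set 1 (.var 16)]

/-- The factor `s + 1` in the precision makes all scaled coefficients, and hence all `k i`, smaller
than the table of powers reaches; the other factors take care of table size and depth. -/
theorem setup_estimate {n : ℕ} (hn : 1 ≤ n) {r s B : ℕ} (hr : 1 ≤ r) {b : ℤ} (hb : 0 < b)
    (hbB : b < 2 ^ B) {α : ℕ → ℤ} (hα : ∀ i < n, 0 ≤ α i)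
    (hs : ∑ i ∈ Finset.range n, α i = s)
    (hB : 16 * (2 ^ precision n r s * 2 ^ precision n r s) < (2 : ℤ) ^ B) :
    Setup n (8 * n * n * r) (8 * n * n * r + n) (precision n r s) B b α
      (fun i => (α i * (8 * n * n * r : ℕ) / b).toNat + 1) := by
  have h1 := le_two_pow_precision n r s
  have h2 := depth_le_two_pow_precision n r s
  have hM : 8 * n ≤ 8 * n * n * r := by
    calc 8 * n = 8 * n * 1 * 1 := by ring
      _ ≤ _ := by gcongr
  have hMr : 8 * n * n * r ≤ 8 * n * n * r * r := Nat.le_mul_of_pos_right _ hr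
  have hMrs : 8 * n * n * r * (s + 1) ≤ 8 * n * n * r * r * (s + 1) := by gcongr
  have hT : 300 * (8 * n * n * r * (s + 1)) ≤ 2 ^ precision n r s := by
    refine le_trans ?_ h1
    nlinarith
  have h3 : 4 * n * (precision n r s + 2) ≤ 16 * n * r * (precision n r s + 2) := by
    refine Nat.mul_le_mul_right _ ?_
    nlinarith
  have hle : ∀ i < n, α i ≤ s := fun i hi => hs ▸
    Finset.single_le_sum (f := α) (fun j hj => hα j (Finset.mem_range.1 hj)) (Finset.mem_range.2 hi)
  generalize precision n r s = q at *
  generalize 8 * n * n * r = M at *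
  have hMs : 300 * (M + M * s) ≤ 2 ^ q := by linarith
  have hMs' : 300 * (M + M * s) ≤ (2 : ℤ) ^ q := by exact_mod_cast hMs
  have hM0 : (8 : ℤ) ≤ M := by omega
  have hs0 : (0 : ℤ) ≤ s := Int.natCast_nonneg _
  have hsM : (s : ℤ) ≤ M * s := by nlinarith
  refine ⟨?_, hB, ?_, ?_, hb, hbB, ?_, hα, ?_, ?_, fun i => by omega, ?_⟩
  · by_contra! h
    obtain rfl : q = 0 := by omega
    simp at h2
    nlinarith
  · push_cast; linarith
  · have : 2 * ((n + 1) * (q + 2)) ≤ 2 ^ q := by nlinarith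
    exact_mod_cast this
  · linarith
  · intro i hi
    linarith [hle i hi]
  · intro i hi
    have := hle i hi
    nlinarith
  · intro i hi
    have : 0 ≤ α i * M / b := Int.ediv_nonneg (mul_nonneg (hα i hi) (by omega)) hb.le
    push_cast
    rw [Int.toNat_of_nonneg this]

/-- The relative error of discretization and rounding. -/
theorem error_le {n r s : ℕ} (hn : 1 ≤ n) (hr : 1 ≤ r) {v z vol : ℝ} (hvol : 0 ≤ vol)
    (h1 : v ≤ (1 + 2 * n / (8 * n * n * r : ℕ)) ^ n * vol)
    (h2 : z ≤ v * (1 + 2 / 2 ^ precision n r s) ^ (2 * (n * (precision n r s + 2)))) :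
    z ≤ (1 + 1 / r) * vol := by
  have hd := depth_le_two_pow_precision n r s
  generalize precision n r s = q at *
  have hn' : (1 : ℝ) ≤ n := by exact_mod_cast hn
  have hr' : (1 : ℝ) ≤ r := by exact_mod_cast hr
  have hQ : (0 : ℝ) < 2 ^ q := by positivity
  have hd' : 16 * n * r * (q + 2) ≤ (2 : ℝ) ^ q := by exact_mod_cast hd
  -- With `M = 8 n² r` the exponent `n * (2 n / M)` is exactly `1 / (4 r)`.
  have e1 : (1 + 2 * n / (8 * n * n * r : ℕ) : ℝ) ^ n ≤ Real.exp (1 / (4 * r)) := by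
    calc (1 + 2 * n / (8 * n * n * r : ℕ) : ℝ) ^ n
        ≤ Real.exp (2 * n / (8 * n * n * r : ℕ)) ^ n := by
          refine pow_le_pow_left₀ (by positivity) ?_ _
          rw [add_comm]; exact Real.add_one_le_exp _
      _ = Real.exp (1 / (4 * r)) := by
          rw [← Real.exp_nat_mul]
          congr 1
          push_cast
          field_simp
          norm_num
  -- The number of roundings is `2 (q + 1) n` from counting plus `2 n` from dividing.
  have e2 : (1 + 2 / 2 ^ q : ℝ) ^ (2 * (n * (q + 2))) ≤ Real.exp (1 / (4 * r)) := by
    calc (1 + 2 / 2 ^ q : ℝ) ^ (2 * (n * (q + 2))) ≤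
        Real.exp (2 / 2 ^ q) ^ (2 * (n * (q + 2))) := by
          refine pow_le_pow_left₀ (by positivity) ?_ _
          rw [add_comm]; exact Real.add_one_le_exp _
      _ ≤ Real.exp (1 / (4 * r)) := by
          rw [← Real.exp_nat_mul]
          refine Real.exp_le_exp.2 ?_
          push_cast
          rw [mul_div_assoc', div_le_div_iff₀ hQ (by positivity)]
          linarith
  have e3 : Real.exp (1 / (4 * r)) * Real.exp (1 / (4 * r)) ≤ 1 + 1 / r := by
    rw [← Real.exp_add]
    have h : (1 / (4 * r) + 1 / (4 * r) : ℝ) = 1 / (2 * r) := by field_simp; norm_num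
    rw [h]
    refine (exp_le_of_le_half (by positivity) ?_).trans (le_of_eq ?_)
    · exact one_div_le_one_div_of_le (by norm_num) (by linarith)
    · field_simp
  calc z ≤ v * (1 + 2 / 2 ^ q) ^ (2 * (n * (q + 2))) := h2
    _ ≤ ((1 + 2 * n / (8 * n * n * r : ℕ)) ^ n * vol) *
        (1 + 2 / 2 ^ q) ^ (2 * (n * (q + 2))) := by gcongr
    _ ≤ (Real.exp (1 / (4 * r)) * vol) * Real.exp (1 / (4 * r)) := by gcongr
    _ = (Real.exp (1 / (4 * r)) * Real.exp (1 / (4 * r))) * vol := by ring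
    _ ≤ _ := by gcongr

/-- The counting loop dominates: `3 n` times `q + 3` times `300 * 11 * n² r` gives `9900`, and the
rest fits into the margin up to `11000`. -/
theorem estimate_time {n r M q : ℕ} (hn : 1 ≤ n) (hr1 : 1 ≤ r) (hM : M = 8 * n * n * r) :
    100 + (q + 1) * 20 + (n + 2) * ((q + 3) * ((M + n + 2) * 300) + 30) +
      (n + 2) * ((q + 2) * 20 + 100) ≤ 11000 * (n ^ 3 * r * (q + 3)) := by
  have t1 : n + 2 ≤ 3 * n := by omega
  have t2 : n ≤ n ^ 2 * r := by
    calc n = n ^ 1 * 1 := by ring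
      _ ≤ n ^ 2 * r := Nat.mul_le_mul (Nat.pow_le_pow_right hn (by norm_num)) hr1
  have t3 : M + n + 2 ≤ 11 * (n ^ 2 * r) := by
    have : M = 8 * (n ^ 2 * r) := by rw [hM]; ring
    omega
  have t4 : 1 ≤ n ^ 2 * r := hn.trans t2
  have t5 : n ^ 3 * r = n * (n ^ 2 * r) := by ring
  rw [t5]
  generalize n ^ 2 * r = x at *
  have t6 : (n + 2) * ((q + 3) * ((M + n + 2) * 300)) ≤ 3 * n * ((q + 3) * (11 * x * 300)) := by
    gcongr
  have t7 : (n + 2) * ((q + 2) * 20 + 130) ≤ 3 * n * ((q + 3) * 64) := by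
    gcongr
    omega
  have t8 : n * (q + 3) ≤ n * x * (q + 3) := by
    refine Nat.mul_le_mul_right _ (Nat.le_mul_of_pos_right _ t4)
  have t9 : q + 3 ≤ n * (q + 3) := Nat.le_mul_of_pos_left _ hn
  nlinarith

set_option maxHeartbeats 1000000 in
theorem runs_estimate {n : ℕ} (hn : 1 ≤ n) {c : Fin n → ℤ} (hc : ∀ i, 0 ≤ c i) {b : ℤ} (hb : 0 < b)
    {p d r s B : ℕ} (hp : 0 < p) (hr : r = d / p + 1) (hs : ∑ i, c i = s)
    (hB : 16 * (2 ^ precision n r s * 2 ^ precision n r s) < (2 : ℤ) ^ B)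
    (hbB : b < 2 ^ B) (hpB : (p : ℤ) < 2 ^ B) (hdB : (d : ℤ) < 2 ^ B) {σ : State}
    (h0 : σ.var 0 = n) (h1 : σ.var 1 = b) (h2 : σ.var 2 = p) (h3 : σ.var 3 = d) (h5 : σ.var 5 = s)
    (ha : ∀ i : Fin n, σ.arr 0 (i : ℕ) = c i) (hz : ∀ A ≠ 0, σ.arr A = fun _ => 0) :
    Runs B estimate σ (11000 * (n ^ 3 * r * (precision n r s + 3))) fun τ =>
      vol c b ≤ output τ ∧ output τ ≤ (1 + 1 / r) * vol c b ∧
      Small B (τ.var 0) ∧ Small B (τ.var 1) := by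
  -- The coefficients are extended to all of `ℕ`, where `cnt` and the loop invariants live.
  obtain ⟨α, hα⟩ : ∃ α : ℕ → ℤ, ∀ i : Fin n, α i = c i :=
    ⟨fun i => if h : i < n then c ⟨i, h⟩ else 0, fun i => by simp⟩
  have hα0 : ∀ i < n, 0 ≤ α i := fun i hi => by rw [hα ⟨i, hi⟩]; exact hc _
  have hαs : ∑ i ∈ Finset.range n, α i = s := by
    rw [Finset.sum_range, ← hs]; exact Finset.sum_congr rfl fun i _ => hα i
  have hr1 : 1 ≤ r := by rw [hr]; exact Nat.le_add_left 1 _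
  have hS := setup_estimate hn hr1 hb hbB hα0 hαs hB
  have herr : ∀ v z : ℝ, _ → _ → _ := fun v z => error_le (s := s) (v := v) (z := z) hn hr1
    (MeasureTheory.measureReal_nonneg : 0 ≤ vol c b)
  obtain ⟨k, hk⟩ : ∃ k, k = (fun i => (α i * (8 * n * n * r : ℕ) / b).toNat + 1) := ⟨_, rfl⟩
  rw [← hk] at hS
  have hvol := vol_le_cnt_le c b hb (8 * n * n * r) (by positivity) k hS.one_le_k
    (fun i => by rw [hS.k_eq i i.2, hα])
  have hT := le_two_pow_precision n r s
  have hTeq : precision n r s = Nat.clog 2 (300 * (8 * n * n * r) * r * (s + 1)) := rfl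
  generalize precision n r s = q at *
  obtain ⟨M, hM⟩ : ∃ M, M = 8 * n * n * r := ⟨_, rfl⟩
  rw [← hM] at hS hvol hT hTeq herr
  have htime := estimate_time (q := q) hn hr1 hM
  have hQ := hS.two_le
  have a2 := hS.bits'
  have a3 := hS.target
  have hM0 : (0 : ℤ) ≤ M := Int.natCast_nonneg _
  have hn0 : (1 : ℤ) ≤ n := by exact_mod_cast hn
  have hs0 : (0 : ℤ) ≤ s := Int.natCast_nonneg _
  have hr0 : (1 : ℤ) ≤ r := by exact_mod_cast hr1
  have hrM : (r : ℤ) ≤ M := by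
    rw [hM]
    have : 1 * r ≤ 8 * n * n * r := Nat.mul_le_mul_right _ (by nlinarith)
    exact_mod_cast (one_mul r) ▸ this
  have hT' : 300 * (M : ℤ) * r * (s + 1) ≤ 2 ^ q := by exact_mod_cast hT
  have b1 : (M : ℤ) ≤ M * r := le_mul_of_one_le_right hM0 hr0
  have b2 : (M : ℤ) * r ≤ M * r * (s + 1) := le_mul_of_one_le_right (by positivity) (by linarith)
  have b3 : (s : ℤ) + 1 ≤ M * r * (s + 1) :=
    le_mul_of_one_le_left (by linarith) (by linarith)
  have b4 : (n : ℤ) * r ≤ M := by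
    rw [hM]
    have : n * r ≤ 8 * n * n * r := Nat.mul_le_mul_right _ (by nlinarith)
    exact_mod_cast this
  have b5 : 8 * (n : ℤ) * n ≤ M := by
    rw [hM]
    have : 8 * n * n ≤ 8 * n * n * r := Nat.le_mul_of_pos_right _ hr1
    exact_mod_cast this
  have b6 : (n : ℤ) ≤ n * n := le_mul_of_one_le_left (by linarith) hn0
  have b7 : (d : ℤ) / p ≤ d := Int.ediv_le_self _ (Int.natCast_nonneg _)
  have b8 : 0 ≤ (d : ℤ) / p := Int.ediv_nonneg (Int.natCast_nonneg _) (Int.natCast_nonneg _)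
  have hr' : (d : ℤ) / p + 1 = r := by rw [hr]; push_cast; rfl
  have hM' : 8 * (n : ℤ) * n * r = M := by rw [hM]; push_cast; rfl
  refine Runs.mono ?_ htime fun _ h => h
  refine Runs.set_cons ?_ (by simp; omega) fun v hv => ?_
  · simp only [Expr.fits_add, Expr.fits_div, Expr.fits_var, Expr.fits_lit, Expr.eval_div, Expr.eval_var, Expr.eval_lit, h2, h3, hr', Small]
    and_intros <;> linarith
  replace hv : v = r := by rw [← hr']; simpa [h2, h3] using hv
  subst hv
  refine Runs.set_cons ?_ (by simp; omega) fun v hv => ?_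
  · simp only [Expr.fits_mul, Expr.fits_var, Expr.fits_lit, Expr.eval_mul, Expr.eval_var,
      Expr.eval_lit, State.var_setVar, h0, if_true, Small]
    norm_num [h0, hM']
    and_intros <;> linarith
  replace hv : v = M := by rw [← hM']; simpa [h0] using hv
  subst hv
  refine Runs.set_cons ?_ (by simp; omega) fun v hv => ?_
  · simp [h0, Small]
    and_intros <;> linarith
  replace hv : v = (M + n : ℕ) := by simpa [h0] using hv
  subst hv
  refine Runs.set_cons ?_ (by simp; omega) fun v hv => ?_
  · simp [h5, Small]
    and_intros <;> linarith
  replace hv : v = (300 * M * r * (s + 1) : ℕ) := by simpa [h5] using hv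
  subst hv
  have hclog : Nat.clog 2 (300 * M * r * (s + 1)) = q := hTeq.symm
  have hpl := runs_powerLoop (B := B) (T := 300 * M * r * (s + 1))
    (σ := (((σ.setVar 6 r).setVar 7 M).setVar 8 (M + n : ℕ)).setVar 14
      (300 * M * r * (s + 1) : ℕ)) (by rw [hclog]; linarith) (by simp) (by simp [hz])
  rw [hclog] at hpl
  refine Runs.cons hpl (by simp; omega) ?_
  rintro τ ⟨hA, t9, t10, t5⟩
  have hτ : Ready n M (M + n) q b α τ := by
    refine ⟨?_, ?_, ?_, ?_, t9, t10, ?_, t5⟩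
    · rw [hA.1 _ (by simp)]; simpa using h0
    · rw [hA.1 _ (by simp)]; simpa using h1
    · rw [hA.1 _ (by simp)]; simp
    · rw [hA.1 _ (by simp)]; simp
    · intro i hi
      rw [hA.2 _ (by simp)]
      simpa [hα ⟨i, hi⟩] using ha ⟨i, hi⟩
  refine Runs.cons (runs_countLoop hS hτ ?_ ?_ ?_ ?_) (by simp; omega) ?_
  · rw [hA.2 _ (by simp)]; simp [hz]
  · rw [hA.2 _ (by simp)]; simp [hz]
  · rw [hA.2 _ (by simp)]; simp [hz]
  · rw [hA.2 _ (by simp)]; simp [hz]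
  rintro τ ⟨hτ, hcells⟩
  refine Runs.cons (runs_divideLoop hS hτ hcells) (by simp; omega) ?_
  rintro τ ⟨hap, hs17, hs16⟩
  refine Runs.set_cons (by simpa using hs17) (by simp; omega) fun v hv =>
    Runs.set_cons (by simpa using hs16) (by simp; omega) fun w hw => Runs.nil ?_
  replace hv : v = τ.var 17 := hv
  replace hw : w = τ.var 16 := by simpa using hw
  subst hv hw
  have hout : output (((τ.setVar 0 (τ.var 17))).setVar 1 (τ.var 16)) =
      (τ.var 17 : ℝ) * 2 ^ (τ.var 16) := by simp [output]
  rw [hout]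
  rw [Finset.prod_range] at hap
  push_cast at hap hvol
  refine ⟨hvol.1.trans hap.le, herr _ _ hvol.2 hap.ge, by simpa using hs17, by simpa using hs16⟩


/-! ### The complete algorithm. -/

/-- The approximation algorithm. -/
def volumeProgram : Prog := .block [
  reflectLoop,
  .cond (.bin .le (.var 5) (.var 1)) (.set 1 (.var 1 + .lit 1)) .skip,
  .cond (.bin .le (.var 1) (.lit 0)) (.block [.set 0 (.lit 0), .set 1 (.lit 0)]) estimate]

theorem natAbs_lt_two_pow (z : ℤ) : z.natAbs < 2 ^ bitLength z :=
  Nat.le_pow_clog one_lt_two (z.natAbs + 1)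

theorem abs_lt_two_pow {z : ℤ} {L : ℕ} (h : bitLength z ≤ L) : |z| < 2 ^ L := by
  have := bitLength_le_iff.1 h
  exact abs_lt.2 this

theorem bitLength_le_encodingLength (z : ℤ) : bitLength z ≤ encodingLength z := by
  simp [encodingLength]

section inputLength

variable {n : ℕ} (a : Fin n → ℤ) (b : ℤ) (ε : ℚ)

theorem abs_coeff_lt (i : Fin n) : |a i| < 2 ^ inputLength a b ε := by
  refine abs_lt_two_pow ((bitLength_le_encodingLength _).trans ?_)
  exact (Finset.le_sup (f := fun i => encodingLength (a i)) (Finset.mem_univ i)).trans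
    (le_max_left _ _)

theorem abs_bound_lt : |b| < 2 ^ inputLength a b ε :=
  abs_lt_two_pow ((bitLength_le_encodingLength _).trans
    ((le_max_left _ _).trans (le_max_right _ _)))

theorem encodingLength_le_inputLength : encodingLength ε ≤ inputLength a b ε :=
  (le_max_right _ _).trans (le_max_right _ _)

theorem abs_num_lt : |ε.num| < 2 ^ inputLength a b ε :=
  abs_lt_two_pow ((Nat.le_add_right _ _).trans (encodingLength_le_inputLength a b ε))

theorem den_lt : (ε.den : ℤ) < 2 ^ inputLength a b ε :=
  lt_of_abs_lt (abs_lt_two_pow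
    ((Nat.le_add_left _ _).trans (encodingLength_le_inputLength a b ε)))

theorem two_le_inputLength (hε : 0 < ε) : 2 ≤ inputLength a b ε := by
  refine le_trans ?_ (encodingLength_le_inputLength a b ε)
  have h : ∀ z : ℤ, 0 < z → 1 ≤ bitLength z := fun z hz => by
    by_contra! h
    have := natAbs_lt_two_pow z
    rw [Nat.lt_one_iff.1 h] at this
    omega
  exact Nat.add_le_add (h _ (Rat.num_pos.2 hε)) (h _ (by exact_mod_cast ε.den_pos))

theorem sum_abs_lt (hn : 1 ≤ n) :
    ∑ i, |a i| + 1 ≤ n * 2 ^ inputLength a b ε := by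
  have h : ∑ i, (|a i| + 1) ≤ ∑ _i : Fin n, (2 : ℤ) ^ inputLength a b ε :=
    Finset.sum_le_sum fun i _ => abs_coeff_lt a b ε i
  rw [Finset.sum_add_distrib] at h
  simp at h
  have : (1 : ℤ) ≤ n := by exact_mod_cast hn
  linarith

end inputLength

/-- Raising the right-hand side by one when it is at least the coefficient sum handles the case of
all zeros: a right-hand side `c ≤ 0` after this step means volume zero, and otherwise `estimate`
applies. -/
theorem runs_volumeProgram {n : ℕ} (hn : 1 ≤ n) (a : Fin n → ℤ) (b : ℤ) (ε : ℚ) (hε : 0 < ε)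
    {r s B : ℕ} (hr : r = ε.den / ε.num.toNat + 1) (hs : ∑ i, |a i| = s)
    (hB : B = 2 * precision n r s + inputLength a b ε + 6) :
    Runs B volumeProgram (input a b ε) (12000 * (n ^ 3 * r * (precision n r s + 3))) fun τ =>
      vol a b ≤ output τ ∧ output τ ≤ (1 + 1 / r) * vol a b ∧
      Small B (τ.var 0) ∧ Small B (τ.var 1) := by
  have hL1 := abs_bound_lt a b ε
  have hL2 := abs_num_lt a b ε
  have hL3 := den_lt a b ε
  have hr1 : 1 ≤ r := by rw [hr]; exact Nat.le_add_left 1 _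
  have hT := le_two_pow_precision n r s
  have hd := depth_le_two_pow_precision n r s
  have hBpow : (2 : ℤ) ^ B = 64 * (2 ^ precision n r s * 2 ^ precision n r s) *
      2 ^ inputLength a b ε := by
    rw [hB, pow_add, pow_add, two_mul, pow_add]; ring
  have hest := fun (c : ℤ) (hc : 0 < c) => runs_estimate hn (c := fun i => |a i|)
    (fun i => abs_nonneg _) hc
    (p := ε.num.toNat) (d := ε.den) (r := r) (s := s) (B := B)
    (by have := Rat.num_pos.2 hε; omega) hr hs
  generalize precision n r s = q at *
  generalize inputLength a b ε = L at *
  have hnum := Rat.num_pos.2 hε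
  rw [abs_of_pos hnum] at hL2
  have htime : n * (q + 3) ≤ n ^ 3 * r * (q + 3) := by
    refine Nat.mul_le_mul_right _ ?_
    calc n = n ^ 1 * 1 := by ring
      _ ≤ n ^ 3 * r := Nat.mul_le_mul (Nat.pow_le_pow_right hn (by norm_num)) hr1
  have htime' : n + 1 ≤ n * (q + 3) := by nlinarith
  generalize n ^ 3 * r * (q + 3) = X at *
  have hsq : s + 1 ≤ 2 ^ q := by
    refine le_trans ?_ hT
    exact Nat.le_mul_of_pos_left _ (by positivity)
  have hnq : n + 1 ≤ 2 ^ q := by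
    refine le_trans ?_ hd
    nlinarith [Nat.mul_le_mul_left (16 * n) hr1, Nat.zero_le q,
      Nat.mul_le_mul_left (16 * n * r) (Nat.zero_le q)]
  have hsq' : (s : ℤ) + 1 ≤ 2 ^ q := by exact_mod_cast hsq
  have hnq' : (n : ℤ) + 1 ≤ 2 ^ q := by exact_mod_cast hnq
  have hL : (1 : ℤ) ≤ 2 ^ L := one_le_pow₀ (by norm_num)
  have hq1 : (1 : ℤ) ≤ 2 ^ q := one_le_pow₀ (by norm_num)
  have hq2 : (2 : ℤ) ^ q ≤ 2 ^ q * 2 ^ q := le_mul_of_one_le_left (by positivity) hq1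
  have hq3 : (2 : ℤ) ^ q * 2 ^ q ≤ 2 ^ q * 2 ^ q * 2 ^ L := le_mul_of_one_le_right (by positivity) hL
  have hq4 : (2 : ℤ) ^ L ≤ 2 ^ q * 2 ^ q * 2 ^ L := le_mul_of_one_le_left (by positivity) (by linarith)
  have hB1 : 64 * (2 ^ q * 2 ^ q) ≤ (2 : ℤ) ^ B := by rw [hBpow]; linarith
  have hB2 : 64 * (2 : ℤ) ^ L ≤ 2 ^ B := by rw [hBpow]; linarith
  have hqq : (0 : ℤ) < 2 ^ q * 2 ^ q := by positivity
  obtain ⟨α, hα⟩ : ∃ α : ℕ → ℤ, ∀ i : Fin n, α i = a i :=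
    ⟨fun i => if h : i < n then a ⟨i, h⟩ else 0, fun i => by simp⟩
  have hαs : ∑ i ∈ Finset.range n, |α i| = s := by
    rw [Finset.sum_range, ← hs]; exact Finset.sum_congr rfl fun i _ => by rw [hα i]
  have hs0 : (0 : ℤ) ≤ s := Int.natCast_nonneg _
  refine Runs.cons (runs_reflectLoop (α := α) (n := n) (b := b) (by linarith)
    (by rw [hαs]; linarith) rfl rfl rfl rfl ?_) (by omega) ?_
  · intro i hi
    have h : (input a b ε).arr 0 (i : ℕ) = a ⟨i, hi⟩ := by simp [input, hi]
    rw [h, ← hα]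
  rintro τ ⟨hA, h1, h5, h0⟩
  rw [hαs] at h5
  have hneg : ∑ i ∈ Finset.range n, (if α i < 0 then -α i else 0) =
      ∑ i, (if a i < 0 then -a i else 0) := by
    rw [Finset.sum_range]; exact Finset.sum_congr rfl fun i _ => by rw [hα i]
  have hneg0 : 0 ≤ ∑ i, (if a i < 0 then -a i else 0) :=
    Finset.sum_nonneg fun i _ => by split_ifs <;> omega
  have hneg1 : ∑ i, (if a i < 0 then -a i else 0) ≤ s := by
    rw [← hs]
    refine Finset.sum_le_sum fun i _ => ?_
    split_ifs
    · exact neg_le_abs _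
    · exact abs_nonneg _
  have hvol := vol_eq_vol_abs a b
  rw [hneg] at h1
  obtain ⟨hb1, hb2⟩ := abs_lt.1 hL1
  have hb1' : -2 ^ B < b + ∑ i, (if a i < 0 then -a i else 0) - 2 ∧
      b + ∑ i, (if a i < 0 then -a i else 0) + 2 < 2 ^ B := by
    constructor <;> linarith
  generalize b + ∑ i, (if a i < 0 then -a i else 0) = b' at *
  refine Runs.condSet_cons ?_ (fun _ => ?_) (by simp; omega) fun c hc => ?_
  · simp [h1, h5, Small]
    and_intros <;> (try split_ifs) <;> linarith
  · simp [h1, Small]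
    and_intros <;> linarith
  replace hc : c = if (s : ℤ) ≤ b' then b' + 1 else b' := by simpa [h1, h5] using hc
  have hcB : -2 ^ B < c ∧ c < 2 ^ B := by
    rw [hc]; split_ifs <;> constructor <;> linarith
  have hvolc : vol a b = vol (fun i => |a i|) c := by
    rw [hvol, hc]
    split_ifs with h
    · exact vol_eq_of_sum_le _ (fun i => abs_nonneg _) _ _ (by rw [hs]; exact h)
        (by rw [hs]; linarith)
    · rfl
  have hcond : (Expr.bin .le (.var 1) (.lit 0)).eval (τ.setVar 1 c) = if c ≤ 0 then 1 else 0 := by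
    simp
  refine Runs.cons (T := 11000 * X + 4) (Runs.cond ?_ (by simp) (fun h => ?_) (fun h => ?_))
    (by simp; omega) fun τ h => .nil h
  · simp [Small]
    and_intros <;> (try split_ifs) <;> linarith
  · have hc0 : c ≤ 0 := by
      rw [hcond] at h
      by_contra! h'
      simp [h'] at h
    have hv0 : vol a b = 0 := by
      rw [hvolc]
      -- For `c = 0` the right-hand side was not raised, so the coefficient sum is positive and
      -- `vol_zero` applies.
      rcases hc0.lt_or_eq with hlt | heq
      · exact vol_of_neg _ (fun i => abs_nonneg _) _ hlt
      · rw [heq]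
        refine vol_zero _ (fun i => abs_nonneg _) ?_
        rw [hs]
        rw [hc] at heq
        split_ifs at heq with h'
        · linarith
        · linarith
    refine Runs.set_cons (by simp [Small]) (by simp; omega) fun v hv =>
      Runs.set_cons (by simp [Small]) (by simp; omega) fun w hw => Runs.nil ?_
    replace hv : v = 0 := by simpa using hv
    replace hw : w = 0 := by simpa using hw
    simp [output, hv0, hv, hw, Small]
  · have hc0 : 0 < c := by
      rw [hcond] at h
      by_contra! h'
      simp [h'] at h
    rw [hvolc]
    refine (hest c hc0 (by linarith) hcB.2 (by rw [Int.toNat_of_nonneg hnum.le]; linarith)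
      (by linarith) ?_ ?_ ?_ ?_ ?_ ?_ ?_).mono (by simp) fun _ h => h
    · rw [State.var_setVar, if_neg (by norm_num), hA.1 0 (by simp)]; rfl
    · simp
    · rw [State.var_setVar, if_neg (by norm_num), hA.1 2 (by simp), Int.toNat_of_nonneg hnum.le]
      rfl
    · rw [State.var_setVar, if_neg (by norm_num), hA.1 3 (by simp)]; rfl
    · simpa using h5
    · intro i
      simpa [hα] using h0 i i.2
    · intro A hA0
      rw [State.arr_setVar, hA.2 A (by simpa using hA0)]
      obtain ⟨A, rfl⟩ := Nat.exists_eq_succ_of_ne_zero hA0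
      rfl

/-! ### Translation into the stated bounds. -/

/-- Here `r = ⌊1/ε⌋ + 1`, so `1/ε < r ≤ 1/ε + 1`, and both `1/ε` and `1` are at most `1 / min ε 1`.
-/
theorem ratio_bounds {ε : ℚ} (hε : 0 < ε) {r : ℕ} (hr : r = ε.den / ε.num.toNat + 1) :
    (1 : ℝ) / r ≤ ε ∧ (r : ℝ) ≤ 2 / min (ε : ℝ) 1 := by
  have hnum := Rat.num_pos.2 hε
  obtain ⟨p, hp⟩ : ∃ p, p = ε.num.toNat := ⟨_, rfl⟩
  have hp0 : 0 < p := by omega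
  have hpR : (0 : ℝ) < p := by exact_mod_cast hp0
  have hdR : (0 : ℝ) < ε.den := by exact_mod_cast ε.den_pos
  have hεp : (ε : ℝ) = p / ε.den := by
    rw [Rat.cast_def]
    congr 1
    have : (p : ℤ) = ε.num := by omega
    exact_mod_cast congrArg (Int.cast (R := ℝ)) this.symm
  rw [← hp] at hr
  have h1 : ε.den < r * p := by
    rw [hr, mul_comm]
    exact Nat.lt_mul_div_succ _ hp0
  have h2 : (r : ℝ) ≤ ε.den / p + 1 := by
    rw [hr]
    push_cast
    gcongr
    exact Nat.cast_div_le
  have hr0 : (0 : ℝ) < r := by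
    have : 0 < r := by rw [hr]; exact Nat.succ_pos _
    exact_mod_cast this
  have h1' : (ε.den : ℝ) < r * p := by exact_mod_cast h1
  constructor
  · rw [hεp, div_le_div_iff₀ hr0 hdR]; linarith
  · have hε0 : (0 : ℝ) < ε := by exact_mod_cast hε
    have hm : 0 < min (ε : ℝ) 1 := lt_min hε0 one_pos
    have h3 : (ε.den : ℝ) / p = 1 / ε := by rw [hεp]; field_simp
    rw [h3] at h2
    have h4 : 1 / (ε : ℝ) ≤ 1 / min (ε : ℝ) 1 := one_div_le_one_div_of_le hm (min_le_left _ _)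
    have h5 : 1 ≤ 1 / min (ε : ℝ) 1 := by
      rw [le_div_iff₀ hm]; linarith [min_le_right (ε : ℝ) 1]
    calc (r : ℝ) ≤ 1 / min (ε : ℝ) 1 + 1 / min (ε : ℝ) 1 := by linarith
      _ = _ := by ring

theorem precision_le {n r s L : ℕ} {δ : ℝ} (hn : 1 ≤ n) (hδ : 0 < δ) (hδ1 : δ ≤ 1)
    (hr1 : 1 ≤ r) (hr : (r : ℝ) ≤ 2 / δ) (hs : s + 1 ≤ n * 2 ^ L) :
    (precision n r s : ℝ) ≤ 3 * Real.logb 2 (n / δ) + L + 15 := by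
  have hn' : (1 : ℝ) ≤ n := by exact_mod_cast hn
  have hx : 0 < n / δ := by positivity
  have hs' : (s : ℝ) + 1 ≤ n * 2 ^ L := by exact_mod_cast hs
  obtain ⟨T, hT⟩ : ∃ T, T = 300 * (8 * n * n * r) * r * (s + 1) := ⟨_, rfl⟩
  have hT1 : 1 < T := by
    have : 1 ≤ n * n * r * r * (s + 1) := by
      have : 0 < n * n * r * r * (s + 1) := by positivity
      omega
    nlinarith
  have hlt : 2 ^ (precision n r s - 1) < T := by
    rw [precision, ← hT]
    exact Nat.pow_pred_clog_lt_self one_lt_two hT1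
  have hpos : 1 ≤ precision n r s := by
    rw [precision, ← hT]
    exact Nat.clog_pos one_lt_two hT1
  have h2 : 2 ^ precision n r s ≤ 2 * T := by
    obtain ⟨j, hj⟩ := Nat.exists_eq_add_of_le' hpos
    rw [hj] at hlt ⊢
    rw [pow_succ]
    simp at hlt
    omega
  have h2' : (2 : ℝ) ^ precision n r s ≤ 2 * T := by exact_mod_cast h2
  -- Two factors `r ≤ 2 / δ` give `4800 * 4 = 19200 ≤ 2 ^ 15`; one more factor `1 / δ ≥ 1` completes
  -- the cube of `n / δ`.
  have hTle : 2 * (T : ℝ) ≤ 2 ^ 15 * (n / δ) ^ 3 * 2 ^ L := by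
    have e1 : (1 : ℝ) ≤ 1 / δ := by rw [le_div_iff₀ hδ]; linarith
    calc 2 * (T : ℝ) = 4800 * n ^ 2 * r ^ 2 * (s + 1) := by rw [hT]; push_cast; ring
      _ ≤ 4800 * n ^ 2 * (2 / δ) ^ 2 * (n * 2 ^ L) := by gcongr
      _ = 19200 * n ^ 3 * (1 / δ) ^ 2 * 2 ^ L := by ring
      _ ≤ 2 ^ 15 * n ^ 3 * (1 / δ) ^ 3 * 2 ^ L := by
          have : (1 / δ) ^ 2 ≤ (1 / δ) ^ 3 := pow_le_pow_right₀ e1 (by norm_num)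
          gcongr
          norm_num
      _ = _ := by ring
  have hlog := Real.logb_le_logb_of_le (b := 2) (by norm_num) (by positivity) (h2'.trans hTle)
  rw [Real.logb_mul (by positivity) (by positivity), Real.logb_mul (by positivity) (by positivity),
    Real.logb_pow, Real.logb_pow, Real.logb_pow, Real.logb_pow, Real.logb_self_eq_one (by norm_num)]
    at hlog
  push_cast at hlog
  linarith

/-- Only `P ≤ P ^ 4` is used for the last factor. The constant is `12000 * 2 * 12 = 288000`. -/
theorem time_bound {t x r q δ P : ℝ} (ht : t ≤ 12000 * (x ^ 3 * r * (q + 3))) (hx : 0 ≤ x)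
    (hδ : 0 < δ) (hr : r ≤ 2 / δ) (hq : q + 3 ≤ 12 * P) (hq0 : 0 ≤ q) (hP : 2 ≤ P) :
    t ≤ 300000 * (x ^ 3 / δ * P ^ 4) := by
  have hP4 : P ≤ P ^ 4 := le_self_pow₀ (by linarith) (by norm_num)
  calc t ≤ 12000 * (x ^ 3 * r * (q + 3)) := ht
    _ ≤ 12000 * (x ^ 3 * (2 / δ) * (12 * P ^ 4)) := by
        gcongr
        linarith
    _ = 288000 * (x ^ 3 / δ * P ^ 4) := by ring
    _ ≤ _ := by gcongr; norm_num

end TruncatedCube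

theorem mainTheorem4 :
    ∃ (p : TruncatedCube.Prog) (C : ℝ),
      ∀ (n : ℕ) (a : Fin n → ℤ) (b : ℤ) (ε : ℚ), 1 ≤ n → 0 < ε →
        ∃ (t B : ℕ) (σ : TruncatedCube.State),
          TruncatedCube.Exec B p (TruncatedCube.input a b ε) t σ ∧
          TruncatedCube.vol a b ≤ TruncatedCube.output σ ∧
          TruncatedCube.output σ ≤ (1 + (ε : ℝ)) * TruncatedCube.vol a b ∧
          TruncatedCube.bitLength (σ.var 0) ≤ B ∧ TruncatedCube.bitLength (σ.var 1) ≤ B ∧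
          (t : ℝ) ≤ C * ((n : ℝ) ^ 3 / min (ε : ℝ) 1 *
            (Real.logb 2 ((n : ℝ) / min (ε : ℝ) 1) + TruncatedCube.inputLength a b ε) ^ 4) ∧
          (B : ℝ) ≤ C * (TruncatedCube.inputLength a b ε +
            Real.logb 2 ((n : ℝ) / min (ε : ℝ) 1)) := by
  refine ⟨TruncatedCube.volumeProgram, 300000, fun n a b ε hn hε => ?_⟩
  obtain ⟨r, hr⟩ : ∃ r, r = ε.den / ε.num.toNat + 1 := ⟨_, rfl⟩
  obtain ⟨s, hs⟩ := Int.eq_ofNat_of_zero_le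
    (Finset.sum_nonneg fun i _ => abs_nonneg (a i) : 0 ≤ ∑ i, |a i|)
  obtain ⟨t, σ, hexec, ht, h1, h2, h3, h4⟩ :=
    TruncatedCube.runs_volumeProgram hn a b ε hε hr hs rfl
  obtain ⟨hr1, hr2⟩ := TruncatedCube.ratio_bounds hε hr
  have hvol : 0 ≤ TruncatedCube.vol a b := MeasureTheory.measureReal_nonneg
  have hsum := TruncatedCube.sum_abs_lt a b ε hn
  rw [hs] at hsum
  have hε0 : (0 : ℝ) < ε := by exact_mod_cast hε
  have hδ : 0 < min (ε : ℝ) 1 := lt_min hε0 one_pos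
  have hδ1 : min (ε : ℝ) 1 ≤ 1 := min_le_right _ _
  have hq := TruncatedCube.precision_le (n := n) (s := s) hn hδ hδ1
    (by rw [hr]; exact Nat.le_add_left 1 _) hr2 (by exact_mod_cast hsum)
  have hL : (2 : ℝ) ≤ TruncatedCube.inputLength a b ε := by
    exact_mod_cast TruncatedCube.two_le_inputLength a b ε hε
  have hn' : (1 : ℝ) ≤ n := by exact_mod_cast hn
  have hlog : 0 ≤ Real.logb 2 ((n : ℝ) / min (ε : ℝ) 1) := by
    refine Real.logb_nonneg (by norm_num) ?_
    rw [le_div_iff₀ hδ]; linarith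
  refine ⟨t, _, σ, hexec, h1, h2.trans ?_, TruncatedCube.bitLength_le_iff.2 h3,
    TruncatedCube.bitLength_le_iff.2 h4, ?_, ?_⟩
  · exact mul_le_mul_of_nonneg_right (by linarith) hvol
  · have ht' : (t : ℝ) ≤ 12000 * (n ^ 3 * r * (TruncatedCube.precision n r s + 3)) := by
      exact_mod_cast ht
    set P := Real.logb 2 ((n : ℝ) / min (ε : ℝ) 1) + TruncatedCube.inputLength a b ε with hP
    have hP2 : 2 ≤ P := by linarith
    -- The additive constant `15 + 3` is absorbed because the input length is at least `2`.
    have hqP : (TruncatedCube.precision n r s : ℝ) + 3 ≤ 12 * P := by linarith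
    exact TruncatedCube.time_bound ht' (by linarith) hδ hr2 hqP (by positivity) hP2
  · push_cast
    linarith
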